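/- **Setting.** Let $\psi:\mathbf R\to\mathbf R$ be a symmetric cone obstacle, i.e. $\psi|_{(-\infty,1/2]}$ is affine and $\psi=\psi(1-\cdot)$, such that $\psi$ is uniformly continuous, $\psi<0$ on $(-\infty,0]\cup[1,\infty)$ and $\max_{[0,1]}\psi>0$. Let $A$ be the set of all $\gamma=(\gamma^1,\gamma^2)\in W^{2,2}(0,1;\mathbf R^2)$ with $\gamma'(x)\neq0$ and $\gamma^2(x)\ge\psi(\gamma^1(x))$ for all $x\in[0,1]$, $\gamma(0)=(0,0)$ and $\gamma(1)=(1,0)$. Let $A_{\rm sym}$ be the set of $\gamma\in A$ with $\gamma(1-x)=(1-\gamma^1(x),\gamma^2(x))$ for all $x\in[0,1]$, and let $A_{\rm graph}\subset A$ be the set of curves $x\mapsto(x,u(x))$ with $u\in W^{2,2}(0,1)\cap W^{1,2}_0(0,1)$ and $u\ge\psi$ on $[0,1]$. For $\gamma\in A$ let $L$ be its length, $\tilde\gamma:[0,L]\to\mathbf R^2$ its arclength parametrization and $k=\langle\tilde\gamma'',R_{\pi/2}\tilde\gamma'\rangle$ its signed curvature as a function of arclength, where $R_{\pi/2}$ is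 the counterclockwise rotation by $\pi/2$. A curve $\gamma\in A$ is called a *symmetric cut-and-glued free-elastica* (SCF) if 1. $\tilde\gamma(L-s)=(1-\tilde\gamma^1(s),\tilde\gamma^2(s))$ for all $s\in[0,L]$; 2. $k$ is a classical ($C^2$) solution of $2k''+k^3=0$ on $(0,\tfrac L2)$; 3. $k(0)=0$, i.e. $\lim_{s\downarrow0}k(s)=0$; 4. $k<0$ on $(0,\tfrac L2)$; 5. $\tilde\gamma(\tfrac L2)=(\tfrac12,\psi(\tfrac12))$. Let $h_*:=2/\mathsf B(\tfrac34,\tfrac12)$, where $\mathsf B$ is the Beta function. With $q=\tfrac1{\sqrt2}$, $\mathrm K=\int_0^{\pi/2}\frac{d\theta}{\sqrt{1-q^2\sin^2\theta}}$, $\mathrm E(x)=\int_0^x\sqrt{1-q^2\sin^2\theta}\,d\theta$, $\mathrm E=\mathrm E(\tfrac\pi2)$, $\operatorname{am}$ the inverse function of $x\mapsto\int_0^x\frac{d\theta}{\sqrt{1-q^2\sin^2\theta}}$, $\operatorname{cn}=\cos\circ\operatorname{am}$ and $\alpha_0:=4\mathrm E-2\mathrm K$, let $$\gamma_{\rm rect}(s)=\frac1{\alpha_0}\begin{pmatrix}2\mathrm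 E(\operatorname{am}(\alpha_0s-\mathrm K))+2\mathrm E-\alpha_0s\\ \sqrt2\,\operatorname{cn}(\alpha_0s-\mathrm K)\end{pmatrix},\qquad s\in[0,2\mathrm K/\alpha_0].$$ "Up to reparametrization" refers to orientation-preserving $C^1$-diffeomorphisms of the parameter intervals. **Lemma (unique existence of symmetric cut-and-glued free-elasticae).** There exists an SCF $\gamma\in A$, it is unique up to reparametrization, and it can be parametrized so that $\gamma\in A_{\rm sym}$. Moreover, the SCF $\gamma$ satisfies: * (i) if $\psi(\tfrac12)<h_*$, then $\gamma\in A_{\rm graph}$ up to reparametrization, and $\lim_{s\uparrow L/2}k'(s)$ exists and is $<0$; * (ii) if $\psi(\tfrac12)=h_*$, then $\gamma=\gamma_{\rm rect}$ up to reparametrization; in particular $k'(\tfrac L2)=0$, and no reparametrization of $\gamma$ belongs to $A_{\rm graph}$; * (iii) if $\psi(\tfrac12)>h_*$, then no reparametrization of $\gamma$ belongs to $A_{\rm graph}$, and $\lim_{s\uparrow L/2}k'(s)$ exists and is $>0$. -/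

import Mathlib

open Set Filter Topology MeasureTheory
open scoped ContDiff

noncomputable section

namespace ElasticObstacle

/-- The Euclidean plane. -/
abbrev Plane := EuclideanSpace ℝ (Fin 2)

/-! ### The Sobolev space `W^{2,2}(0,1)` -/

/-- `g` is a weak derivative of `f` on the interval `(0,1)`: integration by parts against every
test function in `C_c^∞(0,1)`. -/
def HasWeakDeriv {E : Type*} [NormedAddCommGroup E] [NormedSpace ℝ E] (f g : ℝ → E) : Prop :=
  ∀ φ : ℝ → ℝ, ContDiff ℝ ∞ φ → HasCompactSupport φ → tsupport φ ⊆ Ioo 0 1 →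
    ∫ x in Ioo (0 : ℝ) 1, deriv φ x • f x = -∫ x in Ioo (0 : ℝ) 1, φ x • g x

/-- `f` is (the continuous representative on `[0,1]` of) an element of `W^{2,2}(0,1)`.  Only the
values of `f` on `[0,1]` matter. -/
def IsW22 {E : Type*} [NormedAddCommGroup E] [NormedSpace ℝ E] (f : ℝ → E) : Prop :=
  ContinuousOn f (Icc 0 1) ∧ ∃ g h : ℝ → E,
    MemLp g 2 (volume.restrict (Ioo (0 : ℝ) 1)) ∧ MemLp h 2 (volume.restrict (Ioo (0 : ℝ) 1)) ∧
    HasWeakDeriv f g ∧ HasWeakDeriv g h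

/-! ### Obstacles -/

/-- The standing assumptions on the obstacle function: uniform continuity, negativity on
`(-∞,0]` and on `[1,∞)`, and `max_{[0,1]} ψ > 0`. -/
structure IsObstacle (ψ : ℝ → ℝ) : Prop where
  uniformContinuous : UniformContinuous ψ
  neg_left : ∀ x ≤ 0, ψ x < 0
  neg_right : ∀ x, 1 ≤ x → ψ x < 0
  max_pos : ∃ x ∈ Icc (0 : ℝ) 1, 0 < ψ x

/-- Symmetric cone: `ψ` is affine on `(-∞,1/2]` and `ψ = ψ(1 - ·)`. -/
def IsSymmetricCone (ψ : ℝ → ℝ) : Prop :=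
  (∃ a b : ℝ, ∀ x ≤ 1 / 2, ψ x = a * x + b) ∧ ∀ x, ψ x = ψ (1 - x)

/-! ### Admissible curves

A curve `[0,1] → ℝ²` is represented by a function on `ℝ` of which only the values on `[0,1]`
are used. -/

/-- The admissible set `A`: immersed `W^{2,2}`-curves from `(0,0)` to `(1,0)` above the
obstacle. -/
def Admissible (ψ : ℝ → ℝ) : Set (ℝ → Plane) :=
  {γ | IsW22 γ ∧ (∀ x ∈ Icc (0 : ℝ) 1, derivWithin γ (Icc 0 1) x ≠ 0) ∧
    γ 0 = !₂[0, 0] ∧ γ 1 = !₂[1, 0] ∧ ∀ x ∈ Icc (0 : ℝ) 1, ψ (γ x 0) ≤ γ x 1}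

/-- The class `A_sym`. -/
def AdmissibleSym (ψ : ℝ → ℝ) : Set (ℝ → Plane) :=
  {γ | γ ∈ Admissible ψ ∧ ∀ x ∈ Icc (0 : ℝ) 1, γ (1 - x) = !₂[1 - γ x 0, γ x 1]}

/-- The class `A_graph`: curves `x ↦ (x, u x)` with `u ∈ W^{2,2}(0,1) ∩ W^{1,2}_0(0,1)` and
`u ≥ ψ` on `[0,1]`.  For the continuous function `u` in `W^{1,2}`, membership in `W^{1,2}_0`
means `u 0 = u 1 = 0`. -/
def AdmissibleGraph (ψ : ℝ → ℝ) : Set (ℝ → Plane) :=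
  {γ | ∃ u : ℝ → ℝ, IsW22 u ∧ u 0 = 0 ∧ u 1 = 0 ∧ (∀ x ∈ Icc (0 : ℝ) 1, ψ x ≤ u x) ∧
    ∀ x ∈ Icc (0 : ℝ) 1, γ x = !₂[x, u x]}

/-- `γ` on `[a,b]` is an orientation-preserving `C¹`-reparametrization of `η` on `[c,d]`. -/
def IsReparam (a b : ℝ) (γ : ℝ → Plane) (c d : ℝ) (η : ℝ → Plane) : Prop :=
  ∃ σ : ℝ → ℝ, ContDiffOn ℝ 1 σ (Icc a b) ∧ (∀ x ∈ Icc a b, 0 < derivWithin σ (Icc a b) x) ∧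
    σ a = c ∧ σ b = d ∧ ∀ x ∈ Icc a b, γ x = η (σ x)

/-- `γ` belongs to `A_graph` after a reparametrization. -/
def IsGraphical (ψ : ℝ → ℝ) (γ : ℝ → Plane) : Prop :=
  ∃ η ∈ AdmissibleGraph ψ, IsReparam 0 1 γ 0 1 η

/-! ### Arclength parametrization and signed curvature -/

/-- Arclength of `γ` on `[0,x]`. -/
def arclength (γ : ℝ → Plane) (x : ℝ) : ℝ :=
  ∫ y in (0 : ℝ)..x, ‖derivWithin γ (Icc 0 1) y‖

/-- The length `L[γ]`. -/
def curveLength (γ : ℝ → Plane) : ℝ := arclength γ 1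

/-- The arclength parametrization of `γ`, meaningful on `[0, L[γ]]`. -/
def arcParam (γ : ℝ → Plane) (s : ℝ) : Plane :=
  γ (Function.invFunOn (arclength γ) (Icc 0 1) s)

/-- The unit tangent as a function of arclength. -/
def unitTangent (γ : ℝ → Plane) : ℝ → Plane := deriv (arcParam γ)

/-- The unit normal, i.e. the unit tangent rotated by `π/2` counterclockwise. -/
def unitNormal (γ : ℝ → Plane) (s : ℝ) : Plane := !₂[-(unitTangent γ s 1), unitTangent γ s 0]

/-- The signed curvature as a function of arclength `s ∈ (0, L[γ])`: the inner product of the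
second arclength derivative with the unit normal.  For an immersed `W^{2,2}`-curve the unit
tangent is absolutely continuous, so that this is defined for almost every `s`. -/
def signedCurvature (γ : ℝ → Plane) (s : ℝ) : ℝ :=
  inner ℝ (deriv (unitTangent γ) s) (unitNormal γ s)

/-! ### Symmetric cut-and-glued free elasticae -/

/-- Symmetric cut-and-glued free-elastica.  On `(0,L/2)` the signed curvature `k` is a classical
solution of `2k'' + k³ = 0`; the value `k(0)` is the limit of `k(s)` as `s ↓ 0`.  (At a point
where the second derivative of the arclength parametrization fails to exist, `signedCurvature` is
`0` by convention, so the sign condition forces the existence on all of `(0,L/2)`.)  Symmetry is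
required of the arclength parametrization, hence does not depend on how `γ` is parametrized. -/
structure IsSCF (ψ : ℝ → ℝ) (γ : ℝ → Plane) : Prop where
  mem : γ ∈ Admissible ψ
  symm : ∀ s ∈ Icc 0 (curveLength γ),
    arcParam γ (curveLength γ - s) = !₂[1 - arcParam γ s 0, arcParam γ s 1]
  contDiffOn : ContDiffOn ℝ 2 (signedCurvature γ) (Ioo 0 (curveLength γ / 2))
  elastica : ∀ s ∈ Ioo 0 (curveLength γ / 2),
    2 * deriv (deriv (signedCurvature γ)) s + signedCurvature γ s ^ 3 = 0
  zero : Tendsto (signedCurvature γ) (𝓝[>] 0) (𝓝 0)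
  neg : ∀ s ∈ Ioo 0 (curveLength γ / 2), signedCurvature γ s < 0
  tip : arcParam γ (curveLength γ / 2) = !₂[1 / 2, ψ (1 / 2)]

/-! ### Elliptic functions, the rectangular elastica and the critical height -/

/-- Incomplete elliptic integral of the first kind with modulus `q`. -/
def ellF (x q : ℝ) : ℝ := ∫ θ in (0 : ℝ)..x, 1 / √(1 - q ^ 2 * Real.sin θ ^ 2)

/-- Incomplete elliptic integral of the second kind with modulus `q`. -/
def ellE (x q : ℝ) : ℝ := ∫ θ in (0 : ℝ)..x, √(1 - q ^ 2 * Real.sin θ ^ 2)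

/-- Complete elliptic integral of the first kind. -/
def completeK (q : ℝ) : ℝ := ellF (Real.pi / 2) q

/-- Complete elliptic integral of the second kind. -/
def completeE (q : ℝ) : ℝ := ellE (Real.pi / 2) q

/-- The Jacobian amplitude: the inverse function of `x ↦ ellF x q`, for `0 ≤ q < 1`. -/
def jacobiAm (x q : ℝ) : ℝ := Function.invFun (fun y => ellF y q) x

/-- The Jacobian elliptic function `cn`. -/
def jacobiCn (x q : ℝ) : ℝ := Real.cos (jacobiAm x q)

/-- The modulus `1/√2`. -/
def qRect : ℝ := 1 / √2

/-- The constant `α₀ = 4 E(1/√2) - 2 K(1/√2)`. -/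
def alphaRect : ℝ := 4 * completeE qRect - 2 * completeK qRect

/-- The length of the rectangular elastica. -/
def lengthRect : ℝ := 2 * completeK qRect / alphaRect

/-- The rectangular elastica, meaningful on `[0, lengthRect]`. -/
def gammaRect (s : ℝ) : Plane :=
  (1 / alphaRect) •
    !₂[2 * ellE (jacobiAm (alphaRect * s - completeK qRect) qRect) qRect + 2 * completeE qRect
        - alphaRect * s,
      √2 * jacobiCn (alphaRect * s - completeK qRect) qRect]

/-- The critical height `h_* = 2 / B(3/4, 1/2)`; the real Beta function is
`ProbabilityTheory.beta a b = Γ(a) Γ(b) / Γ(a + b)`. -/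
def hStar : ℝ := 2 / ProbabilityTheory.beta (3 / 4) (1 / 2)

end ElasticObstacle

end

open ElasticObstacle

noncomputable section

namespace ElasticObstacle

/-! ### Inverses of functions with derivative bounded below -/

/-! Up to rotation and scaling there is only one curve that issues from the origin with vanishing,
then negative, curvature solving `2k'' + k³ = 0`: the rectangular elastica. Normalized, it has
coordinates `X = rectX`, `Y = rectY`, unit tangent `(Y²/2, S)` with `S = rectS`, and curvature `-Y`;
here `X' = Y²/2`, `Y' = S`, `S' = -Y³/2`, and the next inflection is at `2K`. Hence the left half of
an SCF is an arc `[0, σ]` of this curve, rotated and scaled (`elastica_curvature`,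
`elastica_curve`). Symmetry makes the tangent at the tip horizontal, which fixes the rotation; the
abscissa `1/2` of the tip fixes the scale. Only `σ` remains unknown, and the height `h = ψ(1/2)` is
the only condition left.

In the frame of tangent and normal at `σ`, the endpoint of the arc has coordinates `H = shootH σ`
and `V = shootV σ`, so the condition is `V = 2hH` with `H > 0`. The set where `H > 0` is an initial
interval of `(0, 2K)`, and `V / H` increases strictly there, so that each `h > 0` has exactly one
solution `σ` (`shooting_exists`, `shooting_unique`).

At `σ = K` the slope `V / H` equals `2 * hStar` (`beta_eq_alphaRect`, `slope_mid`). Comparing `h`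
with `hStar` therefore amounts to comparing `σ` with `K`, that is, to reading off the sign of `rectS
σ`. This one number controls every case: it is the horizontal component of the initial tangent after
rotation, and `-(scale σ)² * rectS σ` is the limit of `k'` at the tip. If it is positive, the
tangent points to the right all along and the curve is a graph; otherwise the initial tangent rules
a graph out.

Conversely, the arc for this `σ`, continued by reflection, is a `C²` curve. It stays above the chord
from the origin to the tip (`IsShooting.chord_le`), while the cone stays below that chord because
`ψ(0) < 0`. Finally, `W^{2,2}` curves are `C¹`, which makes arclength parametrizations and tangents
available for an arbitrary SCF. -/

lemma exists_inverse_of_le_deriv {P p : ℝ → ℝ} {m : ℝ} (hm : 0 < m) (hpm : ∀ x, m ≤ p x)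
    (hP : ∀ x, HasDerivAt P (p x) x) :
    StrictMono P ∧ ∃ Q : ℝ → ℝ, (∀ x, Q (P x) = x) ∧ (∀ y, P (Q y) = y) ∧
      ∀ y, HasDerivAt Q (1 / p (Q y)) y := by
  have hmono : StrictMono P := strictMono_of_deriv_pos fun x => by
    rw [(hP x).deriv]; exact hm.trans_le (hpm x)
  have hcont : Continuous P := continuous_iff_continuousAt.2 fun x => (hP x).continuousAt
  -- This gives at least linear growth at both ends, hence surjectivity.
  have hmono' : Monotone fun x => P x - m * x := by
    have hd : ∀ x, HasDerivAt (fun x => P x - m * x) (p x - m) x := fun x => by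
      exact ((hP x).sub ((hasDerivAt_id x).const_mul m)).congr_deriv (by simp)
    refine monotone_of_deriv_nonneg (fun x => (hd x).differentiableAt) fun x => ?_
    rw [(hd x).deriv]; linarith [hpm x]
  have htop : Tendsto P atTop atTop := by
    refine tendsto_atTop_mono' _ ((eventually_ge_atTop 0).mono fun x hx => ?_)
      (tendsto_atTop_add_const_left _ (P 0) (tendsto_id.const_mul_atTop hm))
    have := hmono' hx
    simp only [id] at *; linarith
  have hbot : Tendsto P atBot atBot := by
    refine tendsto_atBot_mono' _ ((eventually_le_atBot 0).mono fun x hx => ?_)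
      (tendsto_atBot_add_const_left _ (P 0) (tendsto_id.const_mul_atBot hm))
    have := hmono' hx
    simp only [id] at *; linarith
  let e := hmono.orderIsoOfSurjective P (hcont.surjective htop hbot)
  have h1 : ∀ x, e.symm (P x) = x := fun x => e.symm_apply_apply x
  have h2 : ∀ y, P (e.symm y) = y := fun y => e.apply_symm_apply y
  refine ⟨hmono, e.symm, h1, h2, fun y => ?_⟩
  rw [one_div]
  exact HasDerivAt.of_local_left_inverse e.symm.continuous.continuousAt (hP _)
    (hm.trans_le (hpm _)).ne' (Eventually.of_forall h2)

/-- The `C¹` diffeomorphism of the line that integrates a given positive continuous function on an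
interval. -/
lemma exists_diffeo_of_pos {a b : ℝ} (hab : a ≤ b) {p : ℝ → ℝ} (hp : ContinuousOn p (Icc a b))
    (hpos : ∀ x ∈ Icc a b, 0 < p x) :
    ∃ P Q p' : ℝ → ℝ, Continuous p' ∧ (∀ x ∈ Icc a b, p' x = p x) ∧ (∀ x, 0 < p' x) ∧
      StrictMono P ∧ P a = 0 ∧
      (∀ x, HasDerivAt P (p' x) x) ∧ (∀ x, Q (P x) = x) ∧ (∀ y, P (Q y) = y) ∧
      ∀ y, HasDerivAt Q (1 / p' (Q y)) y := by
  -- Extension by the endpoint values keeps continuity and the positive lower bound on the whole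
  -- line, so that all later derivatives are two-sided.
  set p' : ℝ → ℝ := IccExtend hab (domRestrict (Icc a b) p)
  have hc : Continuous p' := (continuousOn_iff_continuous_domRestrict.1 hp).Icc_extend'
  have heq : ∀ x ∈ Icc a b, p' x = p x := fun x hx => IccExtend_of_mem hab _ hx
  obtain ⟨x₀, hx₀, hmin⟩ := isCompact_Icc.exists_isMinOn (nonempty_Icc.2 hab) hp
  have hle : ∀ x, p x₀ ≤ p' x := fun x => hmin (projIcc a b hab x).2
  have hP : ∀ x, HasDerivAt (fun x => ∫ y in a..x, p' y) (p' x) x := fun x =>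
    intervalIntegral.integral_hasDerivAt_right (hc.intervalIntegrable _ _)
      (hc.stronglyMeasurableAtFilter _ _) hc.continuousAt
  obtain ⟨hm, Q, h1, h2, h3⟩ := exists_inverse_of_le_deriv (hpos x₀ hx₀) hle hP
  exact ⟨_, Q, p', hc, heq, fun x => (hpos x₀ hx₀).trans_le (hle x), hm, by simp, hP, h1, h2, h3⟩

/-! ### Elliptic functions of modulus `1/√2` -/

lemma qRect_sq : qRect ^ 2 = 1 / 2 := by
  simp [qRect]

lemma delta_pos (θ : ℝ) : 0 < 1 - qRect ^ 2 * Real.sin θ ^ 2 := by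
  rw [qRect_sq]; nlinarith [Real.sin_sq_le_one θ]

lemma continuous_delta : Continuous fun θ : ℝ => √(1 - qRect ^ 2 * Real.sin θ ^ 2) := by fun_prop

lemma hasDerivAt_ellF (x : ℝ) :
    HasDerivAt (fun y => ellF y qRect) (1 / √(1 - qRect ^ 2 * Real.sin x ^ 2)) x := by
  have hc : Continuous fun θ : ℝ => 1 / √(1 - qRect ^ 2 * Real.sin θ ^ 2) :=
    continuous_const.div continuous_delta fun θ => (Real.sqrt_pos.2 (delta_pos θ)).ne'
  exact intervalIntegral.integral_hasDerivAt_right (hc.intervalIntegrable _ _)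
    (hc.stronglyMeasurableAtFilter _ _) hc.continuousAt

lemma hasDerivAt_ellE (x : ℝ) :
    HasDerivAt (fun y => ellE y qRect) (√(1 - qRect ^ 2 * Real.sin x ^ 2)) x :=
  intervalIntegral.integral_hasDerivAt_right (continuous_delta.intervalIntegrable _ _)
    (continuous_delta.stronglyMeasurableAtFilter _ _) continuous_delta.continuousAt

/-- The integrand is at least `1`, so `ellF` is a bijection of the line and the `Function.invFun` in
`jacobiAm` is a genuine inverse. -/
lemma ellF_inverse : StrictMono (fun y => ellF y qRect) ∧
    (∀ x, jacobiAm (ellF x qRect) qRect = x) ∧ (∀ u, ellF (jacobiAm u qRect) qRect = u) ∧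
    ∀ u, HasDerivAt (fun u => jacobiAm u qRect) (√(1 - qRect ^ 2 * Real.sin (jacobiAm u qRect) ^ 2))
      u := by
  have hle : ∀ x : ℝ, 1 ≤ 1 / √(1 - qRect ^ 2 * Real.sin x ^ 2) := fun x => by
    rw [le_div_iff₀ (Real.sqrt_pos.2 (delta_pos x)), one_mul]
    exact Real.sqrt_le_one.2 (by nlinarith [sq_nonneg (qRect * Real.sin x)])
  obtain ⟨hm, Q, h1, h2, h3⟩ := exists_inverse_of_le_deriv one_pos hle hasDerivAt_ellF
  have hQ : (fun u => jacobiAm u qRect) = Q := by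
    funext u
    apply hm.injective
    have : ∃ y, (fun y => ellF y qRect) y = u := ⟨Q u, h2 u⟩
    exact (Function.invFun_eq this).trans (h2 u).symm
  have hQ' : ∀ u, jacobiAm u qRect = Q u := fun u => congrFun hQ u
  refine ⟨hm, fun x => by rw [hQ', h1], fun u => by rw [hQ']; exact h2 u, fun u => ?_⟩
  rw [hQ, hQ']
  simpa using h3 u

lemma ellF_neg (x : ℝ) : ellF (-x) qRect = -ellF x qRect := by
  have := intervalIntegral.integral_comp_neg (a := 0) (b := x)
    fun θ : ℝ => 1 / √(1 - qRect ^ 2 * Real.sin θ ^ 2)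
  rw [neg_zero, intervalIntegral.integral_symm 0] at this
  simp only [Real.sin_neg, neg_sq] at this
  simp only [ellF]; linarith

lemma ellE_neg (x : ℝ) : ellE (-x) qRect = -ellE x qRect := by
  have := intervalIntegral.integral_comp_neg (a := 0) (b := x)
    fun θ : ℝ => √(1 - qRect ^ 2 * Real.sin θ ^ 2)
  rw [neg_zero, intervalIntegral.integral_symm 0] at this
  simp only [Real.sin_neg, neg_sq] at this
  simp only [ellE]; linarith

lemma jacobiAm_neg (u : ℝ) : jacobiAm (-u) qRect = -jacobiAm u qRect := by
  obtain ⟨hm, h1, h2, -⟩ := ellF_inverse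
  apply hm.injective
  simp only [ellF_neg, h2]

lemma jacobiAm_zero : jacobiAm 0 qRect = 0 := by
  obtain ⟨hm, h1, h2, -⟩ := ellF_inverse
  have := h1 0
  simpa [ellF] using this

lemma jacobiAm_completeK : jacobiAm (completeK qRect) qRect = Real.pi / 2 := ellF_inverse.2.1 _

lemma strictMono_jacobiAm : StrictMono fun u => jacobiAm u qRect := fun u v huv => by
  obtain ⟨hm, h1, h2, -⟩ := ellF_inverse
  refine hm.lt_iff_lt.1 ?_
  simpa only [h2] using huv

lemma completeK_pos : 0 < completeK qRect := by
  have := ellF_inverse.1 (show (0 : ℝ) < Real.pi / 2 by positivity)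
  simpa [ellF, completeK] using this

/-! ### The rectangular elastica before scaling -/

/-- The height of the rectangular elastica, which is also the absolute value of its curvature. -/
def rectY (t : ℝ) : ℝ := √2 * jacobiCn (t - completeK qRect) qRect

/-- The horizontal coordinate of the rectangular elastica. -/
def rectX (t : ℝ) : ℝ :=
  2 * ellE (jacobiAm (t - completeK qRect) qRect) qRect + 2 * completeE qRect - t

/-- The vertical component of the unit tangent of the rectangular elastica. -/
def rectS (t : ℝ) : ℝ :=
  -(√2 * Real.sin (jacobiAm (t - completeK qRect) qRect) *
    √(1 - qRect ^ 2 * Real.sin (jacobiAm (t - completeK qRect) qRect) ^ 2))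

/-- This is unit speed of the tangent `(rectY² / 2, rectS)` and at the same time conservation of the
energy `k'² + k⁴/4`. -/
lemma rectS_sq_add (t : ℝ) : rectS t ^ 2 + rectY t ^ 4 / 4 = 1 := by
  simp only [rectS, rectY, jacobiCn]
  set θ := jacobiAm (t - completeK qRect) qRect
  have h2 : √2 ^ 2 = (2 : ℝ) := Real.sq_sqrt (by norm_num)
  have hd := Real.sq_sqrt (delta_pos θ).le
  have hc := Real.cos_sq' θ
  calc _ = √2 ^ 2 * Real.sin θ ^ 2 * √(1 - qRect ^ 2 * Real.sin θ ^ 2) ^ 2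
        + (√2 ^ 2) ^ 2 * (Real.cos θ ^ 2) ^ 2 / 4 := by ring
    _ = 1 := by rw [hd, h2, hc, qRect_sq]; ring

lemma hasDerivAt_am_shift (t : ℝ) :
    HasDerivAt (fun t => jacobiAm (t - completeK qRect) qRect)
      (√(1 - qRect ^ 2 * Real.sin (jacobiAm (t - completeK qRect) qRect) ^ 2)) t :=
  (ellF_inverse.2.2.2 (t - completeK qRect)).comp_sub_const t _

lemma hasDerivAt_rectY (t : ℝ) : HasDerivAt rectY (rectS t) t := by
  have h := ((hasDerivAt_am_shift t).cos).const_mul √2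
  refine h.congr_deriv ?_
  simp only [rectS]; ring

lemma hasDerivAt_rectX (t : ℝ) : HasDerivAt rectX (rectY t ^ 2 / 2) t := by
  have h := ((((hasDerivAt_ellE _).comp t (hasDerivAt_am_shift t)).const_mul 2).add_const
    (2 * completeE qRect)).sub (hasDerivAt_id t)
  refine h.congr_deriv ?_
  -- The modulus enters through `2 (1 - sin² θ / 2) - 1 = cos² θ`.
  rw [Real.mul_self_sqrt (delta_pos _).le]
  simp only [rectY, jacobiCn, mul_pow]
  rw [Real.sq_sqrt (by norm_num), Real.cos_sq', qRect_sq]; ring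

lemma hasDerivAt_rectS (t : ℝ) : HasDerivAt rectS (-(rectY t ^ 3 / 2)) t := by
  have ha := hasDerivAt_am_shift t
  set θ := jacobiAm (t - completeK qRect) qRect with hθ
  have hd : HasDerivAt (fun t => √(1 - qRect ^ 2 *
      Real.sin (jacobiAm (t - completeK qRect) qRect) ^ 2)) _ t :=
    (((ha.sin.pow 2).const_mul (qRect ^ 2)).const_sub 1).sqrt (delta_pos θ).ne'
  refine (((ha.sin.const_mul √2).mul hd).neg).congr_deriv ?_
  have hs : √(1 - qRect ^ 2 * Real.sin θ ^ 2) ≠ 0 := (Real.sqrt_pos.2 (delta_pos θ)).ne'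
  have hs2 := Real.sq_sqrt (delta_pos θ).le
  have h2 : √2 ^ 2 = (2 : ℝ) := Real.sq_sqrt (by norm_num)
  simp only [rectY, jacobiCn, ← hθ, Pi.pow_apply]
  set D := √(1 - qRect ^ 2 * Real.sin θ ^ 2)
  rw [qRect_sq] at hs2 ⊢
  have hc := Real.cos_sq' θ
  have h3 : (√2 * Real.cos θ) ^ 3 = 2 * √2 * Real.cos θ * (1 - Real.sin θ ^ 2) := by
    rw [← hc]; linear_combination √2 * Real.cos θ ^ 3 * h2
  rw [h3]
  field_simp
  simp only [Nat.cast_ofNat, Nat.add_one_sub_one, pow_one]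
  linear_combination (-(4 * Real.cos θ)) * hs2

lemma rectY_symm (t : ℝ) : rectY (2 * completeK qRect - t) = rectY t := by
  simp only [rectY, jacobiCn]
  rw [show 2 * completeK qRect - t - completeK qRect = -(t - completeK qRect) by ring, jacobiAm_neg,
    Real.cos_neg]

lemma rectX_mid : rectX (completeK qRect) = alphaRect / 2 := by
  simp only [rectX, sub_self, jacobiAm_zero, alphaRect]
  simp [ellE]; ring

lemma rectX_symm (t : ℝ) :
    rectX (2 * completeK qRect - t) = alphaRect - rectX t := by
  simp only [rectX]
  rw [show 2 * completeK qRect - t - completeK qRect = -(t - completeK qRect) by ring, jacobiAm_neg,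
    ellE_neg, alphaRect]; ring

lemma rectX_zero : rectX 0 = 0 := by
  simp only [rectX, zero_sub, jacobiAm_neg, jacobiAm_completeK, ellE_neg, completeE]; ring

lemma rectY_zero : rectY 0 = 0 := by
  simp [rectY, jacobiCn, jacobiAm_neg, jacobiAm_completeK]

lemma rectY_two_completeK : rectY (2 * completeK qRect) = 0 := by
  rw [← rectY_symm, sub_self, rectY_zero]

lemma rectY_mid : rectY (completeK qRect) = √2 := by
  simp [rectY, jacobiCn, jacobiAm_zero]

lemma rectS_mid : rectS (completeK qRect) = 0 := by simp [rectS, jacobiAm_zero]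

lemma rectS_zero : rectS 0 = 1 := by
  simp only [rectS, zero_sub, jacobiAm_neg, jacobiAm_completeK, Real.sin_neg, Real.sin_pi_div_two,
    qRect_sq]
  rw [show (1 - 1 / 2 * (-1) ^ 2 : ℝ) = 1 / 2 by norm_num, mul_neg_one, neg_mul, neg_neg,
    ← Real.sqrt_mul (by norm_num)]
  norm_num

lemma am_shift_mem {t : ℝ} (h0 : 0 < t) (h1 : t < 2 * completeK qRect) :
    jacobiAm (t - completeK qRect) qRect ∈ Ioo (-(Real.pi / 2)) (Real.pi / 2) := by
  constructor
  · rw [← jacobiAm_completeK, ← jacobiAm_neg]; exact strictMono_jacobiAm (by linarith)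
  · rw [← jacobiAm_completeK]; exact strictMono_jacobiAm (by linarith)

lemma rectY_pos {t : ℝ} (h0 : 0 < t) (h1 : t < 2 * completeK qRect) : 0 < rectY t :=
  mul_pos (by positivity) (Real.cos_pos_of_mem_Ioo (am_shift_mem h0 h1))

lemma rectY_nonneg {t : ℝ} (h0 : 0 ≤ t) (h1 : t ≤ 2 * completeK qRect) : 0 ≤ rectY t := by
  rcases h0.eq_or_lt with rfl | h0
  · exact rectY_zero.ge
  rcases h1.eq_or_lt with rfl | h1
  · exact rectY_two_completeK.ge
  exact (rectY_pos h0 h1).le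

lemma continuous_rectX : Continuous rectX :=
  continuous_iff_continuousAt.2 fun t => (hasDerivAt_rectX t).continuousAt

lemma continuous_rectY : Continuous rectY :=
  continuous_iff_continuousAt.2 fun t => (hasDerivAt_rectY t).continuousAt

lemma continuous_rectS : Continuous rectS :=
  continuous_iff_continuousAt.2 fun t => (hasDerivAt_rectS t).continuousAt

lemma strictAntiOn_rectS : StrictAntiOn rectS (Icc 0 (2 * completeK qRect)) := by
  refine strictAntiOn_of_deriv_neg (convex_Icc _ _) continuous_rectS.continuousOn fun t ht => ?_
  rw [interior_Icc] at ht
  rw [(hasDerivAt_rectS t).deriv]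
  have := rectY_pos ht.1 ht.2
  have : 0 < rectY t ^ 3 / 2 := by positivity
  linarith

lemma strictMonoOn_rectX : StrictMonoOn rectX (Icc 0 (2 * completeK qRect)) := by
  refine strictMonoOn_of_deriv_pos (convex_Icc _ _) continuous_rectX.continuousOn fun t ht => ?_
  rw [interior_Icc] at ht
  rw [(hasDerivAt_rectX t).deriv]
  have := rectY_pos ht.1 ht.2
  positivity

lemma rectX_pos {t : ℝ} (h0 : 0 < t) (h1 : t ≤ 2 * completeK qRect) : 0 < rectX t := by
  have hK := completeK_pos
  rw [← rectX_zero]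
  exact strictMonoOn_rectX ⟨le_rfl, by linarith⟩ ⟨h0.le, h1⟩ h0

lemma alphaRect_pos : 0 < alphaRect := by
  have := rectX_pos completeK_pos (by linarith [completeK_pos])
  rw [rectX_mid] at this; linarith

lemma gammaRect_eq (s : ℝ) :
    gammaRect s = (1 / alphaRect) • !₂[rectX (alphaRect * s), rectY (alphaRect * s)] := rfl

/-! ### The shooting problem

`shootH t` and `shootV t` are the coordinates of the point `(rectX t, rectY t)` in the frame formed
by the unit tangent and the unit normal at that point. -/

/-- Tangential component of the position vector of the rectangular elastica. -/
def shootH (t : ℝ) : ℝ := rectX t * rectY t ^ 2 / 2 + rectY t * rectS t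

/-- Normal component of the position vector of the rectangular elastica. -/
def shootV (t : ℝ) : ℝ := rectY t ^ 3 / 2 - rectX t * rectS t

/-- The factor `shootH / rectY`. -/
def shootZ (t : ℝ) : ℝ := rectX t * rectY t / 2 + rectS t

lemma shootH_eq (t : ℝ) : shootH t = rectY t * shootZ t := by simp only [shootH, shootZ]; ring

/-- The position moves with velocity the tangent, whence the `1`; the other term is the Frenet
rotation of the frame, with curvature `-rectY`. -/
lemma hasDerivAt_shootH (t : ℝ) : HasDerivAt shootH (1 - rectY t * shootV t) t := by
  have h := ((((hasDerivAt_rectX t).mul ((hasDerivAt_rectY t).pow 2)).div_const 2).add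
    ((hasDerivAt_rectY t).mul (hasDerivAt_rectS t)))
  refine h.congr_deriv ?_
  simp only [shootV, Pi.pow_apply]
  have := rectS_sq_add t
  push_cast
  linear_combination this

lemma hasDerivAt_shootV (t : ℝ) : HasDerivAt shootV (rectY t * shootH t) t := by
  have h := (((hasDerivAt_rectY t).pow 3).div_const 2).sub
    ((hasDerivAt_rectX t).mul (hasDerivAt_rectS t))
  refine h.congr_deriv ?_
  simp only [shootH]
  push_cast
  ring

lemma hasDerivAt_shootZ (t : ℝ) :
    HasDerivAt shootZ (rectX t * rectS t / 2 - rectY t ^ 3 / 4) t := by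
  have h := (((hasDerivAt_rectX t).mul (hasDerivAt_rectY t)).div_const 2).add (hasDerivAt_rectS t)
  refine h.congr_deriv ?_
  ring

lemma shootH_zero : shootH 0 = 0 := by simp [shootH, rectY_zero]

lemma shootV_zero : shootV 0 = 0 := by simp [shootV, rectY_zero, rectX_zero]

lemma shootH_mid : shootH (completeK qRect) = alphaRect / 2 := by
  rw [shootH, rectX_mid, rectY_mid, rectS_mid, Real.sq_sqrt (by norm_num)]; ring

lemma shootV_mid : shootV (completeK qRect) = √2 := by
  rw [shootV, rectY_mid, rectS_mid, pow_succ, Real.sq_sqrt (by norm_num)]; ring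

lemma rectS_pos_iff {t : ℝ} (h0 : 0 ≤ t) (h1 : t ≤ 2 * completeK qRect) :
    0 < rectS t ↔ t < completeK qRect := by
  have := completeK_pos
  rw [← rectS_mid]
  exact strictAntiOn_rectS.lt_iff_gt ⟨by linarith, by linarith⟩ ⟨h0, h1⟩

lemma rectS_neg_iff {t : ℝ} (h0 : 0 ≤ t) (h1 : t ≤ 2 * completeK qRect) :
    rectS t < 0 ↔ completeK qRect < t := by
  have := completeK_pos
  rw [← rectS_mid]
  exact strictAntiOn_rectS.lt_iff_gt ⟨h0, h1⟩ ⟨by linarith, by linarith⟩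

lemma rectX_nonneg {t : ℝ} (h0 : 0 ≤ t) (h1 : t ≤ 2 * completeK qRect) : 0 ≤ rectX t := by
  rcases h0.eq_or_lt with rfl | h0
  · exact rectX_zero.ge
  · exact (rectX_pos h0 h1).le

/-- Beyond `K` the tangent points downwards, so both terms of the derivative are negative. `shootH`
itself is not monotone there, since it vanishes again at `2K`; division by `rectY` removes that
zero. -/
lemma strictAntiOn_shootZ :
    StrictAntiOn shootZ (Icc (completeK qRect) (2 * completeK qRect)) := by
  have hK := completeK_pos
  refine strictAntiOn_of_deriv_neg (convex_Icc _ _)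
    (fun t _ => (hasDerivAt_shootZ t).continuousAt.continuousWithinAt) fun t ht => ?_
  rw [interior_Icc] at ht
  rw [(hasDerivAt_shootZ t).deriv]
  have h0 : 0 < t := hK.trans ht.1
  have hX := rectX_pos h0 ht.2.le
  have hY := rectY_pos h0 ht.2
  have hS := (rectS_neg_iff h0.le ht.2.le).2 ht.1
  have : 0 < rectY t ^ 3 := by positivity
  nlinarith [mul_pos hX (neg_pos.2 hS)]

lemma shootZ_pos_left {t : ℝ} (h0 : 0 ≤ t) (h1 : t ≤ completeK qRect) : 0 < shootZ t := by
  have hK := completeK_pos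
  rcases h1.eq_or_lt with rfl | h1
  · have := rectX_pos hK (by linarith)
    simp only [shootZ, rectS_mid, rectY_mid]; positivity
  · have h2 := (rectS_pos_iff h0 (by linarith)).2 h1
    have h3 := rectX_nonneg h0 (by linarith)
    have h4 := rectY_nonneg h0 (by linarith)
    simp only [shootZ]; positivity

/-- The set where `shootH` is positive is an initial interval. -/
lemma shootZ_pos_of_le {s t : ℝ} (h0 : 0 ≤ s) (hst : s ≤ t) (ht : t ≤ 2 * completeK qRect)
    (hZ : 0 < shootZ t) : 0 < shootZ s := by
  rcases le_total s (completeK qRect) with h | h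
  · exact shootZ_pos_left h0 h
  · exact hZ.trans_le (strictAntiOn_shootZ.antitoneOn ⟨h, hst.trans ht⟩ ⟨h.trans hst, ht⟩ hst)

lemma exists_shootZ_eq_zero :
    ∃ t ∈ Ioo (completeK qRect) (2 * completeK qRect), shootZ t = 0 := by
  have hK := completeK_pos
  have h1 : shootZ (2 * completeK qRect) < 0 := by
    simp only [shootZ, rectY_two_completeK, mul_zero, zero_div, zero_add]
    exact (rectS_neg_iff (by linarith) le_rfl).2 (by linarith)
  exact intermediate_value_Ioo' (by linarith : completeK qRect ≤ 2 * completeK qRect)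
    (fun t _ => (hasDerivAt_shootZ t).continuousAt.continuousWithinAt)
    ⟨h1, shootZ_pos_left hK.le le_rfl⟩

lemma shootH_pos_iff {t : ℝ} (h0 : 0 < t) (h1 : t < 2 * completeK qRect) :
    0 < shootH t ↔ 0 < shootZ t := by
  rw [shootH_eq, mul_pos_iff_of_pos_left (rectY_pos h0 h1)]

lemma shootH_two_completeK : shootH (2 * completeK qRect) = 0 := by
  simp [shootH, rectY_two_completeK]

lemma shootH_pos_of_le {s t : ℝ} (h0 : 0 < s) (hst : s ≤ t) (ht : t ≤ 2 * completeK qRect)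
    (hH : 0 < shootH t) : 0 < shootH s := by
  have ht' : t < 2 * completeK qRect := ht.lt_of_ne fun h => by
    rw [h, shootH_two_completeK] at hH; exact hH.false
  rw [shootH_pos_iff (h0.trans_le hst) ht'] at hH
  rw [shootH_pos_iff h0 (hst.trans_lt ht')]
  exact shootZ_pos_of_le h0.le hst ht hH

/-- Where `shootH` is negative, `shootV` is nonnegative. -/
lemma shootV_nonneg_of_shootH_neg {t : ℝ} (h0 : 0 ≤ t) (h1 : t ≤ 2 * completeK qRect)
    (hH : shootH t < 0) : 0 ≤ shootV t := by
  have hX := rectX_nonneg h0 h1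
  have hY := rectY_nonneg h0 h1
  have hZ : shootZ t < 0 := by
    rw [shootH_eq] at hH
    by_contra! h
    exact absurd hH (not_lt.2 (mul_nonneg hY h))
  have hS : rectS t ≤ 0 := by
    simp only [shootZ] at hZ
    nlinarith [mul_nonneg hX hY]
  simp only [shootV]
  nlinarith [mul_nonneg hX (neg_nonneg.2 hS), pow_nonneg hY 3]

/-- The slope of the chord increases. -/
lemma slope_numerator_pos {t : ℝ} (h0 : 0 < t) (h1 : t < 2 * completeK qRect)
    (hH : 0 ≤ shootH t) :
    0 < rectY t * shootH t * shootH t - shootV t * (1 - rectY t * shootV t) := by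
  have hX := rectX_pos h0 h1.le
  have hY := rectY_pos h0 h1
  have hZ : 0 ≤ shootZ t := by
    rw [shootH_eq] at hH
    exact nonneg_of_mul_nonneg_right hH hY
  have hE := rectS_sq_add t
  -- A rotation preserves `H² + V² = X² + Y²`, so the expression is `Y (X² + Y²) - V`, which equals
  -- `X Z + Y X² / 2 + Y³ / 2` with `Z = shootZ t ≥ 0`.
  have key : rectY t * shootH t * shootH t - shootV t * (1 - rectY t * shootV t)
      = rectY t * rectX t ^ 2 + rectY t ^ 3 / 2 + rectX t * rectS t := by
    simp only [shootH, shootV]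
    linear_combination (rectY t * rectX t ^ 2 + rectY t ^ 3) * hE
  rw [key]
  simp only [shootZ] at hZ
  have h2 : 0 < rectY t ^ 3 := by positivity
  have h3 : 0 < rectY t * rectX t ^ 2 := by positivity
  nlinarith [mul_nonneg hX.le hZ]

lemma strictMonoOn_slope {b : ℝ} (hb : b ≤ 2 * completeK qRect) (hH : 0 < shootH b) :
    StrictMonoOn (fun t => shootV t / shootH t) (Ioc 0 b) := by
  have hpos : ∀ t ∈ Ioc 0 b, 0 < shootH t := fun t ht => shootH_pos_of_le ht.1 ht.2 hb hH
  refine strictMonoOn_of_deriv_pos (convex_Ioc _ _) (fun t ht => ?_) fun t ht => ?_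
  · exact ((hasDerivAt_shootV t).div (hasDerivAt_shootH t)
      (hpos t ht).ne').continuousAt.continuousWithinAt
  · rw [interior_Ioc] at ht
    have h := hpos t ⟨ht.1, ht.2.le⟩
    have hd : deriv (fun t => shootV t / shootH t) t = _ :=
      ((hasDerivAt_shootV t).div (hasDerivAt_shootH t) h.ne').deriv
    rw [hd]
    exact div_pos (slope_numerator_pos ht.1 (ht.2.trans_le hb) h.le) (by positivity)

lemma slope_lt_iff {s t : ℝ} (hs : s ∈ Ioo 0 (2 * completeK qRect))
    (ht : t ∈ Ioo 0 (2 * completeK qRect)) (hHs : 0 < shootH s) (hHt : 0 < shootH t) :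
    shootV s / shootH s < shootV t / shootH t ↔ s < t := by
  rcases le_total s t with h | h
  · exact (strictMonoOn_slope ht.2.le hHt).lt_iff_lt ⟨hs.1, h⟩ ⟨ht.1, le_rfl⟩
  · exact (strictMonoOn_slope hs.2.le hHs).lt_iff_lt ⟨hs.1, le_rfl⟩ ⟨ht.1, h⟩

lemma shooting_unique {h s t : ℝ} (hs : s ∈ Ioo 0 (2 * completeK qRect))
    (ht : t ∈ Ioo 0 (2 * completeK qRect)) (hHs : 0 < shootH s) (hHt : 0 < shootH t)
    (es : shootV s = 2 * h * shootH s) (et : shootV t = 2 * h * shootH t) : s = t := by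
  have h1 : shootV s / shootH s = shootV t / shootH t := by
    rw [es, et, mul_div_cancel_right₀ _ hHs.ne', mul_div_cancel_right₀ _ hHt.ne']
  have a := slope_lt_iff hs ht hHs hHt
  have b := slope_lt_iff ht hs hHt hHs
  rw [h1] at a b
  exact le_antisymm (not_lt.1 fun h => (b.2 h).false) (not_lt.1 fun h => (a.2 h).false)

/-- Intermediate values for `V - 2hH`: just after `0` it is negative, because `H' = 1` and `V' = 0`
there; at the first positive zero `b` of `H` it is positive, because `V' = Y H > 0` up to `b`. -/
lemma shooting_exists {h : ℝ} (hh : 0 < h) :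
    ∃ t ∈ Ioo 0 (2 * completeK qRect), 0 < shootH t ∧ shootV t = 2 * h * shootH t := by
  have hK := completeK_pos
  obtain ⟨b, hb, hZb⟩ := exists_shootZ_eq_zero
  have hb0 : 0 < b := hK.trans hb.1
  have hHpos : ∀ t ∈ Ioo 0 b, 0 < shootH t := fun t ht => by
    rw [shootH_pos_iff ht.1 (ht.2.trans hb.2)]
    rcases le_total t (completeK qRect) with h | h
    · exact shootZ_pos_left ht.1.le h
    · rw [← hZb]
      exact strictAntiOn_shootZ ⟨h, (ht.2.trans hb.2).le⟩ ⟨hb.1.le, hb.2.le⟩ ht.2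
  have hHb : shootH b = 0 := by rw [shootH_eq, hZb, mul_zero]
  have hVb : 0 < shootV b := by
    rw [← shootV_zero]
    refine strictMonoOn_of_deriv_pos (convex_Icc 0 b)
      (fun t _ => (hasDerivAt_shootV t).continuousAt.continuousWithinAt) (fun t ht => ?_)
      (left_mem_Icc.2 hb0.le) (right_mem_Icc.2 hb0.le) hb0
    rw [interior_Icc] at ht
    rw [(hasDerivAt_shootV t).deriv]
    exact mul_pos (rectY_pos ht.1 (ht.2.trans hb.2)) (hHpos t ht)
  have hW : ∀ t, HasDerivAt (fun t => shootV t - 2 * h * shootH t)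
      (rectY t * shootH t - 2 * h * (1 - rectY t * shootV t)) t := fun t =>
    (hasDerivAt_shootV t).sub ((hasDerivAt_shootH t).const_mul (2 * h))
  have h0 := hW 0
  simp only [rectY_zero, zero_mul, sub_zero, mul_one, zero_sub] at h0
  obtain ⟨ε, hε, hneg⟩ : ∃ ε ∈ Ioo 0 b, shootV ε - 2 * h * shootH ε < 0 := by
    have h1 := (hasDerivWithinAt_iff_tendsto_slope' (s := Ioi 0) (by simp)).1
      (h0.hasDerivWithinAt (s := Ioi 0))
    have h2 : ∀ᶠ t in 𝓝[>] (0 : ℝ), slope (fun t => shootV t - 2 * h * shootH t) 0 t < 0 :=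
      h1.eventually_lt_const (by linarith)
    have h3 : ∀ᶠ t in 𝓝[>] (0 : ℝ), t ∈ Ioo 0 b := Ioo_mem_nhdsGT hb0
    obtain ⟨ε, hε, hlt⟩ := (h3.and h2).exists
    refine ⟨ε, hε, ?_⟩
    rw [slope_def_field, sub_zero, shootV_zero, shootH_zero, mul_zero, sub_zero, sub_zero] at hlt
    by_contra! hc
    exact absurd hlt (not_lt.2 (div_nonneg hc hε.1.le))
  obtain ⟨t, ht, hWt⟩ := intermediate_value_Ioo hε.2.le
    (fun t _ => (hW t).continuousAt.continuousWithinAt)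
    (show (0 : ℝ) ∈ Ioo _ _ from ⟨hneg, by simpa [hHb] using hVb⟩)
  refine ⟨t, ⟨hε.1.trans ht.1, ht.2.trans hb.2⟩, hHpos t ⟨hε.1.trans ht.1, ht.2⟩, ?_⟩
  simpa [sub_eq_zero] using hWt

/-! ### The critical height -/

lemma alphaRect_eq_integral :
    alphaRect = 2 * ∫ θ in (0 : ℝ)..(Real.pi / 2),
      Real.cos θ ^ 2 / √(1 - qRect ^ 2 * Real.sin θ ^ 2) := by
  have hc : Continuous fun θ : ℝ => 1 / √(1 - qRect ^ 2 * Real.sin θ ^ 2) :=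
    continuous_const.div continuous_delta fun θ => (Real.sqrt_pos.2 (delta_pos θ)).ne'
  have h : ∀ θ : ℝ, Real.cos θ ^ 2 / √(1 - qRect ^ 2 * Real.sin θ ^ 2) =
      2 * √(1 - qRect ^ 2 * Real.sin θ ^ 2) - 1 / √(1 - qRect ^ 2 * Real.sin θ ^ 2) := fun θ => by
    have h1 := Real.sqrt_pos.2 (delta_pos θ)
    have h2 := Real.sq_sqrt (delta_pos θ).le
    field_simp
    rw [h2, Real.cos_sq', qRect_sq]; ring
  simp_rw [h]
  rw [intervalIntegral.integral_sub ((continuous_delta.const_mul 2).intervalIntegrable _ _)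
    (hc.intervalIntegrable _ _), intervalIntegral.integral_const_mul, alphaRect, completeE,
    completeK, ellE, ellF]
  ring

/-- The substitution `x = 1 - cos⁴ θ` turns `x ^ (-1/2) * (1 - x) ^ (-1/4) dx` into `4 cos² θ / √(1
+ cos² θ) dθ`. Exchanging the arguments of the Beta function makes the substitution increasing; the
integrands are compared on the open interval only, as the Beta integrand is singular at both ends.
-/
lemma beta_eq_alphaRect : ProbabilityTheory.beta (3 / 4) (1 / 2) = √2 * alphaRect := by
  have hcomm : ProbabilityTheory.beta (3 / 4) (1 / 2) = ProbabilityTheory.beta (1 / 2) (3 / 4) := by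
    simp only [ProbabilityTheory.beta]; rw [mul_comm, add_comm]
  have hreal : Complex.betaIntegral ((1 / 2 : ℝ) : ℂ) ((3 / 4 : ℝ) : ℂ) =
      ((∫ x in (0 : ℝ)..1, x ^ (-(1 / 2) : ℝ) * (1 - x) ^ (-(1 / 4) : ℝ) : ℝ) : ℂ) := by
    rw [Complex.betaIntegral, ← intervalIntegral.integral_ofReal]
    refine intervalIntegral.integral_congr fun x hx => ?_
    rw [uIcc_of_le zero_le_one] at hx
    rw [Complex.ofReal_mul, Complex.ofReal_cpow hx.1, Complex.ofReal_cpow (sub_nonneg.2 hx.2)]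
    push_cast
    norm_num
  rw [hcomm, ProbabilityTheory.beta_eq_betaIntegralReal _ _ (by norm_num) (by norm_num), hreal,
    Complex.ofReal_re]
  have hsub := intervalIntegral.integral_comp_mul_deriv_of_deriv_nonneg
    (a := 0) (b := Real.pi / 2) (f := fun θ => 1 - Real.cos θ ^ 4)
    (f' := fun θ => 4 * Real.cos θ ^ 3 * Real.sin θ)
    (g := fun x : ℝ => x ^ (-(1 / 2) : ℝ) * (1 - x) ^ (-(1 / 4) : ℝ)) (by fun_prop)
    (fun θ _ => by
      have := ((Real.hasDerivAt_cos θ).pow 4).const_sub 1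
      refine this.congr_deriv ?_
      push_cast; ring)
    (fun θ hθ => by
      have hp : (0 : ℝ) < Real.pi / 2 := by positivity
      rw [min_eq_left hp.le, max_eq_right hp.le] at hθ
      have h1 := Real.cos_pos_of_mem_Ioo ⟨by linarith [hθ.1], hθ.2⟩
      have h2 := Real.sin_pos_of_pos_of_lt_pi hθ.1 (by linarith [hθ.2])
      positivity)
  simp only [Real.cos_zero, Real.cos_pi_div_two] at hsub
  norm_num at hsub
  norm_num
  rw [← hsub, alphaRect_eq_integral, ← mul_assoc, ← intervalIntegral.integral_const_mul,
    intervalIntegral.integral_of_le (by positivity), intervalIntegral.integral_of_le (by positivity),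
    integral_Ioc_eq_integral_Ioo, integral_Ioc_eq_integral_Ioo]
  refine setIntegral_congr_fun measurableSet_Ioo fun θ hθ => ?_
  have hc := Real.cos_pos_of_mem_Ioo ⟨by linarith [hθ.1, Real.pi_pos], hθ.2⟩
  have hs := Real.sin_pos_of_pos_of_lt_pi hθ.1 (by linarith [hθ.2, Real.pi_pos])
  have hcs := Real.sin_sq_add_cos_sq θ
  have hq : 1 - qRect ^ 2 * Real.sin θ ^ 2 = (1 + Real.cos θ ^ 2) / 2 := by
    rw [qRect_sq]; linarith
  have h1 : 1 - Real.cos θ ^ 4 = Real.sin θ ^ 2 * (1 + Real.cos θ ^ 2) := by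
    linear_combination (-(1 + Real.cos θ ^ 2)) * hcs
  have hroot : (Real.cos θ ^ 4) ^ (-(1 / 4) : ℝ) = (Real.cos θ)⁻¹ := by
    rw [← Real.rpow_natCast, ← Real.rpow_mul hc.le, ← Real.rpow_neg_one]; norm_num
  have hroot2 : (1 - Real.cos θ ^ 4) ^ (-(1 / 2) : ℝ) =
      (Real.sin θ * √(1 + Real.cos θ ^ 2))⁻¹ := by
    rw [Real.rpow_neg (by rw [h1]; positivity), ← Real.sqrt_eq_rpow, h1,
      Real.sqrt_mul (sq_nonneg _), Real.sqrt_sq hs.le]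
  rw [hroot, hroot2, hq, Real.sqrt_div' _ (by norm_num)]
  have h3 : 0 < √(1 + Real.cos θ ^ 2) := by positivity
  have h2 : √2 ^ 2 = (2 : ℝ) := Real.sq_sqrt (by norm_num)
  field_simp
  nlinarith

lemma hStar_eq : hStar = √2 / alphaRect := by
  have h := alphaRect_pos
  have h2 : √2 ^ 2 = (2 : ℝ) := Real.sq_sqrt (by norm_num)
  rw [hStar, beta_eq_alphaRect]
  field_simp
  exact h2.symm

lemma slope_mid :
    shootV (completeK qRect) / shootH (completeK qRect) = 2 * hStar := by
  rw [shootV_mid, shootH_mid, hStar_eq]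
  field_simp

lemma shooting_lt_mid_iff {h t : ℝ} (ht : t ∈ Ioo 0 (2 * completeK qRect)) (hH : 0 < shootH t)
    (e : shootV t = 2 * h * shootH t) : h < hStar ↔ t < completeK qRect := by
  have hK := completeK_pos
  rw [← slope_lt_iff ht ⟨hK, by linarith⟩ hH (by rw [shootH_mid]; linarith [alphaRect_pos]),
    slope_mid, e, mul_div_cancel_right₀ _ hH.ne']
  constructor <;> intro <;> linarith

lemma mid_lt_shooting_iff {h t : ℝ} (ht : t ∈ Ioo 0 (2 * completeK qRect)) (hH : 0 < shootH t)
    (e : shootV t = 2 * h * shootH t) : hStar < h ↔ completeK qRect < t := by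
  have hK := completeK_pos
  rw [← slope_lt_iff ⟨hK, by linarith⟩ ht (by rw [shootH_mid]; linarith [alphaRect_pos]) hH,
    slope_mid, e, mul_div_cancel_right₀ _ hH.ne']
  constructor <;> intro <;> linarith

/-! ### Weak derivatives in one dimension -/

lemma integrableOn_Ioo_smul {E : Type*} [NormedAddCommGroup E] [NormedSpace ℝ E] {φ : ℝ → ℝ}
    {f : ℝ → E} {a b : ℝ} (hφ : Continuous φ) (hf : IntegrableOn f (Ioo a b)) :
    IntegrableOn (fun x => φ x • f x) (Ioo a b) := by
  rw [← integrableOn_Icc_iff_integrableOn_Ioo] at hf ⊢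
  exact hf.continuousOn_smul hφ.continuousOn isCompact_Icc

lemma integrableOn_of_memLp {E : Type*} [NormedAddCommGroup E] {f : ℝ → E}
    (hf : MemLp f 2 (volume.restrict (Ioo (0 : ℝ) 1))) : IntegrableOn f (Ioo 0 1) :=
  hf.integrable (by norm_num)

lemma integrableOn_of_continuousOn {E : Type*} [NormedAddCommGroup E] {f : ℝ → E}
    (hf : ContinuousOn f (Icc 0 1)) : IntegrableOn f (Ioo (0 : ℝ) 1) :=
  hf.integrableOn_Icc.mono_set Ioo_subset_Icc_self

lemma memLp_two_of_continuousOn {E : Type*} [NormedAddCommGroup E] {f : ℝ → E}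
    (hf : ContinuousOn f (Icc 0 1)) : MemLp f 2 (volume.restrict (Ioo (0 : ℝ) 1)) := by
  obtain ⟨C, hC⟩ := isCompact_Icc.exists_bound_of_continuousOn hf
  refine MemLp.of_bound (integrableOn_of_continuousOn hf).aestronglyMeasurable C ?_
  exact ae_restrict_of_forall_mem measurableSet_Ioo fun x hx => hC x (Ioo_subset_Icc_self hx)

lemma setIntegral_Ioo_eq_intervalIntegral {E : Type*} [NormedAddCommGroup E] [NormedSpace ℝ E]
    (f : ℝ → E) : ∫ x in Ioo (0 : ℝ) 1, f x = ∫ x in (0 : ℝ)..1, f x := by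
  rw [intervalIntegral.integral_of_le zero_le_one, integral_Ioc_eq_integral_Ioo]

lemma eq_zero_of_tsupport_subset {φ : ℝ → ℝ} (h : tsupport φ ⊆ Ioo 0 1) {x : ℝ}
    (hx : x ∉ Ioo (0 : ℝ) 1) : φ x = 0 :=
  image_eq_zero_of_notMem_tsupport fun h' => hx (h h')

lemma HasWeakDeriv.comp_clm {E F : Type*} [NormedAddCommGroup E] [NormedSpace ℝ E]
    [NormedAddCommGroup F] [NormedSpace ℝ F] [CompleteSpace E] [CompleteSpace F]
    {f g : ℝ → E} (h : HasWeakDeriv f g)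
    (hf : IntegrableOn f (Ioo 0 1)) (hg : IntegrableOn g (Ioo 0 1)) (L : E →L[ℝ] F) :
    HasWeakDeriv (fun x => L (f x)) (fun x => L (g x)) := by
  intro φ hφ hc hs
  have h1 := congrArg L (h φ hφ hc hs)
  rw [map_neg, ← L.integral_comp_comm (integrableOn_Ioo_smul (hφ.continuous_deriv (by simp)) hf),
    ← L.integral_comp_comm (integrableOn_Ioo_smul hφ.continuous hg)] at h1
  simpa using h1

lemma IsW22.comp_clm {E F : Type*} [NormedAddCommGroup E] [NormedSpace ℝ E]
    [NormedAddCommGroup F] [NormedSpace ℝ F] [CompleteSpace E] [CompleteSpace F]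
    {f : ℝ → E} (h : IsW22 f) (L : E →L[ℝ] F) : IsW22 (fun x => L (f x)) := by
  obtain ⟨hf, g, k, hg, hk, h1, h2⟩ := h
  exact ⟨L.continuous.comp_continuousOn hf, _, _, L.comp_memLp' hg, L.comp_memLp' hk,
    h1.comp_clm (integrableOn_of_continuousOn hf) (integrableOn_of_memLp hg) L,
    h2.comp_clm (integrableOn_of_memLp hg) (integrableOn_of_memLp hk) L⟩

lemma hasWeakDeriv_of_hasDerivAt {E : Type*} [NormedAddCommGroup E] [NormedSpace ℝ E]
    [CompleteSpace E] {f f' : ℝ → E} (hc : ContinuousOn f (Icc 0 1))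
    (hf : ∀ x ∈ Ioo (0 : ℝ) 1, HasDerivAt f (f' x) x) (hf' : ContinuousOn f' (Icc 0 1)) :
    HasWeakDeriv f f' := by
  intro φ hφ _ hs
  have h := intervalIntegral.integral_smul_deriv_eq_deriv_smul_of_hasDerivAt (a := 0) (b := 1)
    (u := φ) (u' := deriv φ) (v := f) (v' := f') hφ.continuous.continuousOn
    (by rwa [uIcc_of_le zero_le_one])
    (fun x _ => (hφ.differentiable (by simp) x).hasDerivAt)
    (fun x hx => hf x (by rwa [min_eq_left zero_le_one, max_eq_right zero_le_one] at hx))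
    ((hφ.continuous_deriv (by simp)).intervalIntegrable _ _)
    (ContinuousOn.intervalIntegrable (by rwa [uIcc_of_le zero_le_one]))
  rw [eq_zero_of_tsupport_subset hs (by simp), eq_zero_of_tsupport_subset hs (by simp)] at h
  rw [setIntegral_Ioo_eq_intervalIntegral, setIntegral_Ioo_eq_intervalIntegral, h]
  simp

lemma isW22_of_hasDerivAt {E : Type*} [NormedAddCommGroup E] [NormedSpace ℝ E]
    [CompleteSpace E] {f f' f'' : ℝ → E} (hc : ContinuousOn f (Icc 0 1))
    (hf : ∀ x ∈ Ioo (0 : ℝ) 1, HasDerivAt f (f' x) x) (hc' : ContinuousOn f' (Icc 0 1))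
    (hf' : ∀ x ∈ Ioo (0 : ℝ) 1, HasDerivAt f' (f'' x) x) (hc'' : ContinuousOn f'' (Icc 0 1)) :
    IsW22 f :=
  ⟨hc, f', f'', memLp_two_of_continuousOn hc', memLp_two_of_continuousOn hc'',
    hasWeakDeriv_of_hasDerivAt hc hf hc', hasWeakDeriv_of_hasDerivAt hc' hf' hc''⟩

/-- A smooth function with compact support in an interval and vanishing integral is the derivative
of a test function. -/
lemma exists_test_primitive {w : ℝ → ℝ} (hw : ContDiff ℝ ∞ w) (hc : HasCompactSupport w)
    (hs : tsupport w ⊆ Ioo 0 1) (h0 : ∫ x, w x = 0) :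
    ∃ W : ℝ → ℝ, ContDiff ℝ ∞ W ∧ HasCompactSupport W ∧ tsupport W ⊆ Ioo 0 1 ∧ deriv W = w := by
  have hd : ∀ x, HasDerivAt (fun x => ∫ y in (0 : ℝ)..x, w y) (w x) x := fun x =>
    intervalIntegral.integral_hasDerivAt_right (hw.continuous.intervalIntegrable _ _)
      (hw.continuous.stronglyMeasurableAtFilter _ _) hw.continuous.continuousAt
  have hdw : deriv (fun x => ∫ y in (0 : ℝ)..x, w y) = w := funext fun x => (hd x).deriv
  -- A compact support inside the open interval keeps a distance from its ends, and the primitive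
  -- inherits this distance.
  obtain ⟨a, b, ha, hb, hab⟩ : ∃ a b : ℝ, 0 < a ∧ b < 1 ∧ tsupport w ⊆ Icc a b := by
    rcases (tsupport w).eq_empty_or_nonempty with he | hne
    · exact ⟨1 / 2, 1 / 2, by norm_num, by norm_num, by simp [he]⟩
    · have hcs : IsCompact (tsupport w) := hc
      exact ⟨_, _, (hs (hcs.sInf_mem hne)).1, (hs (hcs.sSup_mem hne)).2, fun x hx =>
        ⟨csInf_le hcs.bddBelow hx, le_csSup hcs.bddAbove hx⟩⟩
  have hwz : ∀ x, x ∉ Icc a b → w x = 0 := fun x hx =>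
    image_eq_zero_of_notMem_tsupport fun h => hx (hab h)
  have hsupp : Function.support (fun x => ∫ y in (0 : ℝ)..x, w y) ⊆ Icc a b := by
    intro x hx
    by_contra hn
    apply hx
    rcases lt_or_ge x a with h | h
    · have hz : EqOn w 0 (uIcc 0 x) := fun y hy => hwz y fun h' => by
        have : y ≤ max 0 x := hy.2
        exact absurd (h'.1.trans this) (not_le.2 (max_lt ha h))
      exact (intervalIntegral.integral_congr hz).trans (by simp)
    · have hbx : b < x := not_le.1 fun h' => hn ⟨h, h'⟩
      -- To the right of `b` the primitive is the full integral of `w`, which is zero.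
      refine Eq.trans (intervalIntegral.integral_eq_integral_of_support_subset fun y hy => ?_) h0
      have := not_imp_comm.1 (hwz y) hy
      exact ⟨ha.trans_le this.1, this.2.trans hbx.le⟩
  have hts : tsupport (fun x => ∫ y in (0 : ℝ)..x, w y) ⊆ Icc a b :=
    closure_minimal hsupp isClosed_Icc
  refine ⟨_, contDiff_infty_iff_deriv.2 ⟨fun x => (hd x).differentiableAt, by rwa [hdw]⟩,
    isCompact_Icc.of_isClosed_subset (isClosed_tsupport _) hts, hts.trans fun x hx =>
      ⟨ha.trans_le hx.1, hx.2.trans_lt hb⟩, hdw⟩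

/-- The lemma of du Bois-Reymond. -/
lemma ae_eq_const_of_weakDeriv_zero {f : ℝ → ℝ} (hf : IntegrableOn f (Ioo 0 1))
    (h : HasWeakDeriv f 0) : ∃ c, ∀ᵐ x ∂volume.restrict (Ioo (0 : ℝ) 1), f x = c := by
  -- A normalized bump `η`: subtracting `(∫ g) η` from a test function `g` leaves integral zero,
  -- hence the derivative of a test function. The constant is then `∫ η f`.
  let B : ContDiffBump (1 / 2 : ℝ) := ⟨1 / 8, 1 / 4, by norm_num, by norm_num⟩
  set η : ℝ → ℝ := B.normed volume with hη
  have hηs : tsupport η ⊆ Ioo 0 1 := by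
    rw [hη, B.tsupport_normed_eq, Real.closedBall_eq_Icc]
    intro x hx
    change 1 / 2 - 1 / 4 ≤ x ∧ x ≤ 1 / 2 + 1 / 4 at hx
    constructor <;> linarith [hx.1, hx.2]
  have hηd : ContDiff ℝ ∞ η := B.contDiff_normed
  have hηc : HasCompactSupport η := B.hasCompactSupport_normed
  set c := ∫ x in Ioo (0 : ℝ) 1, η x * f x
  refine ⟨c, ?_⟩
  have hloc : LocallyIntegrableOn (fun x => f x - c) (Ioo (0 : ℝ) 1) :=
    (hf.sub (integrableOn_const (by simp))).locallyIntegrableOn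
  have key := isOpen_Ioo.ae_eq_zero_of_integral_contDiff_smul_eq_zero hloc ?_
  · filter_upwards [ae_restrict_of_ae key, ae_restrict_mem measurableSet_Ioo] with x hx hm
    linarith [hx hm]
  intro g hg hgc hgs
  set m := ∫ x, g x
  have hm : m = ∫ x in Ioo (0 : ℝ) 1, g x :=
    (setIntegral_eq_integral_of_forall_compl_eq_zero fun x hx =>
      eq_zero_of_tsupport_subset hgs hx).symm
  have hwd : ContDiff ℝ ∞ (fun x => g x - m * η x) := hg.sub (contDiff_const.mul hηd)
  have hws : tsupport (fun x => g x - m * η x) ⊆ tsupport g ∪ tsupport η := by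
    refine closure_minimal (fun x hx => ?_) ((isClosed_tsupport _).union (isClosed_tsupport _))
    by_contra hn
    rw [mem_union, not_or] at hn
    apply hx
    simp [image_eq_zero_of_notMem_tsupport hn.1, image_eq_zero_of_notMem_tsupport hn.2]
  have hgi : Integrable g := hg.continuous.integrable_of_hasCompactSupport hgc
  have hηi : Integrable η := B.integrable_normed
  have hw0 : ∫ x, (g x - m * η x) = 0 := by
    rw [integral_sub hgi (hηi.const_mul m), integral_const_mul, hη, B.integral_normed]
    simp [m]
  obtain ⟨W, hW, hWc, hWs, hWd⟩ := exists_test_primitive hwd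
    ((IsCompact.union hgc hηc).of_isClosed_subset (isClosed_tsupport _) hws)
    (hws.trans (union_subset hgs hηs)) hw0
  have h1 := h W hW hWc hWs
  rw [hWd] at h1
  have e1 : ∫ x, g x • (f x - c) = ∫ x in Ioo (0 : ℝ) 1, g x • (f x - c) :=
    (setIntegral_eq_integral_of_forall_compl_eq_zero fun x hx => by
      rw [eq_zero_of_tsupport_subset hgs hx, zero_smul]).symm
  have i1 : IntegrableOn (fun x => g x * f x) (Ioo 0 1) := integrableOn_Ioo_smul hg.continuous hf
  have i2 : IntegrableOn (fun x => η x * f x) (Ioo 0 1) := integrableOn_Ioo_smul hηd.continuous hf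
  rw [e1]
  simp only [smul_eq_mul, mul_sub, sub_mul, mul_assoc] at h1 ⊢
  rw [integral_sub i1 (i2.const_mul m), integral_const_mul] at h1
  rw [integral_sub i1 (hgi.integrableOn.mul_const c), integral_mul_const, ← hm]
  simpa using h1

/-- The primitive of a merely integrable function is differentiable only almost everywhere, so the
integration by parts is the one for absolutely continuous functions. -/
lemma hasWeakDeriv_primitive {h : ℝ → ℝ} (hh : IntegrableOn h (Ioo 0 1)) :
    HasWeakDeriv (fun x => ∫ y in (0 : ℝ)..x, h y) h := by
  intro φ hφ _ hs
  have hi : IntervalIntegrable h volume 0 1 := by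
    rwa [intervalIntegrable_iff_integrableOn_Ioo_of_le zero_le_one]
  have hac := hi.absolutelyContinuousOnInterval_intervalIntegral (c := 0) (by simp)
  have hφc : AbsolutelyContinuousOnInterval φ 0 1 :=
    ((hφ.of_le (by simp)).contDiffOn (n := 1)).absolutelyContinuousOnInterval
  have hp := hφc.integral_mul_deriv_eq_deriv_mul hac
  rw [eq_zero_of_tsupport_subset hs (by simp), eq_zero_of_tsupport_subset hs (by simp)] at hp
  have he : ∫ x in (0 : ℝ)..1, φ x * deriv (fun x => ∫ y in (0 : ℝ)..x, h y) x =
      ∫ x in (0 : ℝ)..1, φ x * h x := by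
    apply intervalIntegral.integral_congr_ae
    filter_upwards [hi.ae_hasDerivAt_integral] with x hx hm
    rw [(hx (uIoc_subset_uIcc hm) 0 (by simp)).deriv]
  rw [he] at hp
  simp only [setIntegral_Ioo_eq_intervalIntegral, smul_eq_mul, hp]
  simp

lemma ae_eq_primitive_of_hasWeakDeriv {f g : ℝ → ℝ} (hf : IntegrableOn f (Ioo 0 1))
    (hg : IntegrableOn g (Ioo 0 1)) (h : HasWeakDeriv f g) :
    ∃ c, ∀ᵐ x ∂volume.restrict (Ioo (0 : ℝ) 1), f x = c + ∫ y in (0 : ℝ)..x, g y := by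
  have hi : IntegrableOn (fun x => ∫ y in (0 : ℝ)..x, g y) (Ioo 0 1) := by
    refine integrableOn_of_continuousOn ?_
    have := intervalIntegral.continuousOn_primitive_interval (μ := volume) (f := g)
      (a := 0) (b := 1) (by rwa [uIcc_of_le zero_le_one, integrableOn_Icc_iff_integrableOn_Ioo])
    rwa [uIcc_of_le zero_le_one] at this
  obtain ⟨c, hc⟩ := ae_eq_const_of_weakDeriv_zero (hf.sub hi) fun φ hφ hφc hs => by
    have h1 := h φ hφ hφc hs
    have h2 := hasWeakDeriv_primitive hg φ hφ hφc hs
    have hd : Continuous (deriv φ) := hφ.continuous_deriv (by simp)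
    simp only [Pi.sub_apply, smul_sub]
    rw [integral_sub (integrableOn_Ioo_smul hd hf) (integrableOn_Ioo_smul hd hi), h1, h2]
    simp
  exact ⟨c, hc.mono fun x hx => by simp only [Pi.sub_apply] at hx; linarith⟩

/-- `W^{2,2}` functions are continuously differentiable. -/
lemma IsW22.contDiffOn_real {f : ℝ → ℝ} (h : IsW22 f) : ContDiffOn ℝ 1 f (Icc 0 1) := by
  obtain ⟨hf, g, k, hg, hk, h1, h2⟩ := h
  have hgi := integrableOn_of_memLp hg
  have hki := integrableOn_of_memLp hk
  obtain ⟨c, hc⟩ := ae_eq_primitive_of_hasWeakDeriv (integrableOn_of_continuousOn hf) hgi h1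
  obtain ⟨d, hd⟩ := ae_eq_primitive_of_hasWeakDeriv hgi hki h2
  -- The continuous representative of the weak derivative; the indicator makes it continuous on the
  -- whole line.
  set G : ℝ → ℝ := fun x => d + ∫ y in (0 : ℝ)..x, (Ioo (0 : ℝ) 1).indicator k y
  have hG : Continuous G := continuous_const.add
    (intervalIntegral.continuous_primitive
      (fun a b => (hki.integrable_indicator measurableSet_Ioo).intervalIntegrable) 0)
  have hgG : ∀ᵐ x ∂volume.restrict (Ioo (0 : ℝ) 1), g x = G x := by
    filter_upwards [hd, ae_restrict_mem measurableSet_Ioo] with x hx hm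
    rw [hx]
    simp only [G]
    congr 1
    refine intervalIntegral.integral_congr_uIoo fun y hy => ?_
    rw [uIoo_of_le hm.1.le] at hy
    rw [indicator_of_mem (show y ∈ Ioo (0 : ℝ) 1 from ⟨hy.1, hy.2.trans hm.2⟩)]
  have hF : ∀ x, HasDerivAt (fun x => c + ∫ y in (0 : ℝ)..x, G y) (G x) x := fun x =>
    (intervalIntegral.integral_hasDerivAt_right (hG.intervalIntegrable _ _)
      (hG.stronglyMeasurableAtFilter _ _) hG.continuousAt).const_add c
  have hFc : Continuous fun x => c + ∫ y in (0 : ℝ)..x, G y :=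
    continuous_iff_continuousAt.2 fun x => (hF x).continuousAt
  have hfF : EqOn f (fun x => c + ∫ y in (0 : ℝ)..x, G y) (Icc 0 1) := by
    refine Measure.eqOn_Icc_of_ae_eq volume zero_ne_one ?_ hf hFc.continuousOn
    rw [← Measure.restrict_congr_set Ioo_ae_eq_Icc]
    filter_upwards [hc, ae_restrict_mem measurableSet_Ioo] with x hx hm
    rw [hx]
    congr 1
    refine intervalIntegral.integral_congr_ae ?_
    rw [ae_restrict_iff' measurableSet_Ioo] at hgG
    filter_upwards [hgG] with y hy hyx
    rw [uIoc_of_le hm.1.le] at hyx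
    exact hy ⟨hyx.1, hyx.2.trans_lt hm.2⟩
  have hC1 : ContDiff ℝ 1 fun x => c + ∫ y in (0 : ℝ)..x, G y := by
    rw [contDiff_one_iff_deriv]
    refine ⟨fun x => (hF x).differentiableAt, ?_⟩
    rwa [show deriv (fun x => c + ∫ y in (0 : ℝ)..x, G y) = G from funext fun x => (hF x).deriv]
  exact hC1.contDiffOn.congr hfF

lemma IsW22.contDiffOn {f : ℝ → Plane} (h : IsW22 f) : ContDiffOn ℝ 1 f (Icc 0 1) := by
  rw [contDiffOn_euclidean]
  exact fun i => (h.comp_clm (EuclideanSpace.proj (𝕜 := ℝ) i)).contDiffOn_real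

/-! ### Plane curves in coordinates -/

lemma hasDerivAt_plane {a b : ℝ → ℝ} {a' b' s : ℝ} (ha : HasDerivAt a a' s)
    (hb : HasDerivAt b b' s) : HasDerivAt (fun t => (!₂[a t, b t] : Plane)) !₂[a', b'] s := by
  have h : HasDerivAt (fun t => ![a t, b t]) ![a', b'] s := by
    rw [hasDerivAt_pi]
    intro i
    fin_cases i
    · exact ha
    · exact hb
  exact (PiLp.continuousLinearEquiv 2 ℝ (fun _ : Fin 2 => ℝ)).symm.toContinuousLinearMap.hasFDerivAt
    |>.comp_hasDerivAt s h

lemma HasDerivAt.plane_apply {f : ℝ → Plane} {f' : Plane} {s : ℝ} (h : HasDerivAt f f' s)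
    (i : Fin 2) : HasDerivAt (fun t => f t i) (f' i) s :=
  (EuclideanSpace.proj (𝕜 := ℝ) i : Plane →L[ℝ] ℝ).hasFDerivAt.comp_hasDerivAt s h

lemma plane_ext {v w : Plane} (h0 : v 0 = w 0) (h1 : v 1 = w 1) : v = w := by
  ext i
  fin_cases i
  · exact h0
  · exact h1

lemma norm_sq_plane (v : Plane) : ‖v‖ ^ 2 = v 0 ^ 2 + v 1 ^ 2 := by
  rw [EuclideanSpace.norm_sq_eq, Fin.sum_univ_two]; simp

lemma norm_plane_eq_one {v : Plane} (h : v 0 ^ 2 + v 1 ^ 2 = 1) : ‖v‖ = 1 := by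
  have h1 := norm_sq_plane v
  rw [h] at h1
  exact (pow_eq_one_iff_of_nonneg (norm_nonneg v) two_ne_zero).1 h1

/-! ### The arclength parametrization of an immersed `C¹` curve -/

lemma contDiff_one_of_hasDerivAt {f f' : ℝ → ℝ} (h : ∀ x, HasDerivAt f (f' x) x)
    (hc : Continuous f') : ContDiff ℝ 1 f := by
  rw [contDiff_one_iff_deriv, show deriv f = f' from funext fun x => (h x).deriv]
  exact ⟨fun x => (h x).differentiableAt, hc⟩

/-- `P` extends arclength to a diffeomorphism of the line. Its inverse `Q` replaces the
`Function.invFunOn` in `arcParam`, after which the chain rule applies. -/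
lemma exists_arclength_diffeo {γ : ℝ → Plane} (h1 : ContDiffOn ℝ 1 γ (Icc 0 1))
    (h2 : ∀ x ∈ Icc (0 : ℝ) 1, derivWithin γ (Icc 0 1) x ≠ 0) :
    ∃ P Q v : ℝ → ℝ, Continuous v ∧ (∀ x ∈ Icc (0 : ℝ) 1, v x = ‖derivWithin γ (Icc 0 1) x‖) ∧
      (∀ x, 0 < v x) ∧ P 0 = 0 ∧ P 1 = curveLength γ ∧ 0 < curveLength γ ∧
      (∀ x, HasDerivAt P (v x) x) ∧ (∀ x, Q (P x) = x) ∧ (∀ y, P (Q y) = y) ∧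
      (∀ y, HasDerivAt Q (1 / v (Q y)) y) ∧
      (∀ x ∈ Icc (0 : ℝ) 1, P x ∈ Icc 0 (curveLength γ)) ∧
      (∀ s ∈ Icc 0 (curveLength γ), Q s ∈ Icc (0 : ℝ) 1) ∧
      (∀ s ∈ Ioo 0 (curveLength γ), Q s ∈ Ioo (0 : ℝ) 1) ∧
      ∀ s ∈ Icc 0 (curveLength γ), arcParam γ s = γ (Q s) := by
  have hcd : ContinuousOn (derivWithin γ (Icc 0 1)) (Icc 0 1) :=
    h1.continuousOn_derivWithin (uniqueDiffOn_Icc zero_lt_one) le_rfl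
  obtain ⟨P, Q, v, hvc, hv, hvpos, hm, hP0, hP, hQP, hPQ, hQ⟩ :=
    exists_diffeo_of_pos zero_le_one hcd.norm (fun x hx => norm_pos_iff.2 (h2 x hx))
  have harc : ∀ x ∈ Icc (0 : ℝ) 1, arclength γ x = P x := fun x hx => by
    have hF := intervalIntegral.integral_eq_sub_of_hasDerivAt (a := 0) (b := x) (fun y _ => hP y)
      (hvc.intervalIntegrable _ _)
    rw [hP0, sub_zero] at hF
    rw [← hF]
    refine intervalIntegral.integral_congr fun y hy => (hv y ?_).symm
    rw [uIcc_of_le hx.1] at hy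
    exact ⟨hy.1, hy.2.trans hx.2⟩
  have hP1 : P 1 = curveLength γ := (harc 1 (by simp)).symm
  have hQ0 : Q 0 = 0 := by simpa [hP0] using hQP 0
  have hQ1 : Q (curveLength γ) = 1 := by rw [← hP1, hQP]
  have hQm : StrictMono Q := fun s t hst => hm.lt_iff_lt.1 (by rwa [hPQ, hPQ])
  have hQmem : ∀ s ∈ Icc 0 (curveLength γ), Q s ∈ Icc (0 : ℝ) 1 := fun s hs =>
    ⟨hQ0 ▸ hQm.monotone hs.1, hQ1 ▸ hQm.monotone hs.2⟩
  refine ⟨P, Q, v, hvc, hv, hvpos, hP0, hP1, ?_, hP, hQP, hPQ, hQ, ?_, hQmem, ?_, ?_⟩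
  · rw [← hP1, ← hP0]; exact hm zero_lt_one
  · exact fun x hx => ⟨hP0 ▸ hm.monotone hx.1, hP1 ▸ hm.monotone hx.2⟩
  · exact fun s hs => ⟨hQ0 ▸ hQm hs.1, hQ1 ▸ hQm hs.2⟩
  · intro s hs
    have hex : ∃ x ∈ Icc (0 : ℝ) 1, arclength γ x = s :=
      ⟨Q s, hQmem s hs, by rw [harc _ (hQmem s hs), hPQ]⟩
    have hmem := Function.invFunOn_mem hex
    have heq := Function.invFunOn_eq hex
    rw [harc _ hmem] at heq
    rw [arcParam]
    congr 1
    rw [← hQP (Function.invFunOn (arclength γ) (Icc 0 1) s), heq]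

lemma curveLength_pos {γ : ℝ → Plane} (h1 : ContDiffOn ℝ 1 γ (Icc 0 1))
    (h2 : ∀ x ∈ Icc (0 : ℝ) 1, derivWithin γ (Icc 0 1) x ≠ 0) : 0 < curveLength γ := by
  obtain ⟨P, Q, v, -, -, -, -, -, h, -⟩ := exists_arclength_diffeo h1 h2
  exact h

/-- The unit tangent field of an immersed `C¹` curve. -/
lemma exists_unitTangent {γ : ℝ → Plane} (h1 : ContDiffOn ℝ 1 γ (Icc 0 1))
    (h2 : ∀ x ∈ Icc (0 : ℝ) 1, derivWithin γ (Icc 0 1) x ≠ 0) :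
    ∃ T : ℝ → Plane, ContinuousOn T (Icc 0 (curveLength γ)) ∧
      (∀ s ∈ Ioo 0 (curveLength γ), HasDerivAt (arcParam γ) (T s) s) ∧
      (∀ s ∈ Icc 0 (curveLength γ), ‖T s‖ = 1) ∧
      ContinuousOn (arcParam γ) (Icc 0 (curveLength γ)) ∧
      arcParam γ 0 = γ 0 := by
  obtain ⟨P, Q, v, hvc, hv, hvpos, hP0, hP1, hL, hP, hQP, hPQ, hQ, hPm, hQm, hQm', harc⟩ :=
    exists_arclength_diffeo h1 h2
  have hcd : ContinuousOn (derivWithin γ (Icc 0 1)) (Icc 0 1) :=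
    h1.continuousOn_derivWithin (uniqueDiffOn_Icc zero_lt_one) le_rfl
  have hQc : Continuous Q := continuous_iff_continuousAt.2 fun y => (hQ y).continuousAt
  have hQ0 : Q 0 = 0 := by simpa [hP0] using hQP 0
  refine ⟨fun s => (1 / v (Q s)) • derivWithin γ (Icc 0 1) (Q s), ?_, ?_, ?_, ?_, ?_⟩
  · exact ((continuous_const.div (hvc.comp hQc) fun s => (hvpos _).ne').continuousOn).smul
      (hcd.comp hQc.continuousOn hQm)
  · intro s hs
    have hx := hQm' s hs
    have hg : HasDerivAt γ (derivWithin γ (Icc 0 1) (Q s)) (Q s) :=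
      ((h1.differentiableOn one_ne_zero _
        (Ioo_subset_Icc_self hx)).hasDerivWithinAt).hasDerivAt (Icc_mem_nhds hx.1 hx.2)
    refine (hg.scomp s (hQ s)).congr_of_eventuallyEq ?_
    filter_upwards [Ioo_mem_nhds hs.1 hs.2] with t ht
    exact harc t (Ioo_subset_Icc_self ht)
  · intro s hs
    rw [norm_smul, ← hv _ (hQm s hs), Real.norm_of_nonneg (by have := hvpos (Q s); positivity)]
    exact one_div_mul_cancel (hvpos _).ne'
  · exact (h1.continuousOn.comp hQc.continuousOn hQm).congr harc
  · rw [harc 0 ⟨le_rfl, hL.le⟩, hQ0]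

lemma isReparam_of_arcParam_eq {γ G : ℝ → Plane} (h1 : ContDiffOn ℝ 1 γ (Icc 0 1))
    (h2 : ∀ x ∈ Icc (0 : ℝ) 1, derivWithin γ (Icc 0 1) x ≠ 0)
    (h : ∀ s ∈ Icc 0 (curveLength γ), arcParam γ s = G s) :
    IsReparam 0 1 γ 0 (curveLength γ) G := by
  obtain ⟨P, Q, v, hvc, hv, hvpos, hP0, hP1, hL, hP, hQP, hPQ, hQ, hPm, hQm, hQm', harc⟩ :=
    exists_arclength_diffeo h1 h2
  refine ⟨P, (contDiff_one_of_hasDerivAt hP hvc).contDiffOn, fun x hx => ?_, hP0, hP1,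
    fun x hx => ?_⟩
  · rw [(hP x).hasDerivWithinAt.derivWithin (uniqueDiffOn_Icc zero_lt_one x hx)]
    exact hvpos x
  · rw [← h _ (hPm x hx), harc _ (hPm x hx), hQP]

lemma isReparam_of_arcParam_eq_arcParam {γ η : ℝ → Plane} (h1 : ContDiffOn ℝ 1 γ (Icc 0 1))
    (h2 : ∀ x ∈ Icc (0 : ℝ) 1, derivWithin γ (Icc 0 1) x ≠ 0)
    (h1' : ContDiffOn ℝ 1 η (Icc 0 1))
    (h2' : ∀ x ∈ Icc (0 : ℝ) 1, derivWithin η (Icc 0 1) x ≠ 0)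
    (hlen : curveLength γ = curveLength η)
    (h : ∀ s ∈ Icc 0 (curveLength γ), arcParam γ s = arcParam η s) :
    IsReparam 0 1 γ 0 1 η := by
  obtain ⟨P, Q, v, hvc, hv, hvpos, hP0, hP1, hL, hP, hQP, hPQ, hQ, hPm, hQm, hQm', harc⟩ :=
    exists_arclength_diffeo h1 h2
  obtain ⟨P', Q', v', hvc', hv', hvpos', hP0', hP1', hL', hP', hQP', hPQ', hQ', hPm', hQm2', hQm'',
    harc'⟩ := exists_arclength_diffeo h1' h2'
  have hd : ∀ x, HasDerivAt (fun x => Q' (P x)) (1 / v' (Q' (P x)) * v x) x := fun x =>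
    (hQ' (P x)).comp x (hP x)
  have hc : Continuous fun x => 1 / v' (Q' (P x)) * v x := by
    have c1 : Continuous P := continuous_iff_continuousAt.2 fun x => (hP x).continuousAt
    have c2 : Continuous Q' := continuous_iff_continuousAt.2 fun x => (hQ' x).continuousAt
    exact (continuous_const.div (hvc'.comp (c2.comp c1)) fun x => (hvpos' _).ne').mul hvc
  refine ⟨fun x => Q' (P x), (contDiff_one_of_hasDerivAt hd hc).contDiffOn, fun x hx => ?_, ?_, ?_,
    fun x hx => ?_⟩
  · rw [(hd x).hasDerivWithinAt.derivWithin (uniqueDiffOn_Icc zero_lt_one x hx)]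
    have := hvpos x
    have := hvpos' (Q' (P x))
    positivity
  · simpa [hP0, hP0'] using hQP' 0
  · simp only [hP1, hlen]; rw [← hP1', hQP']
  · have hx' := hPm x hx
    rw [← harc' _ (hlen ▸ hx'), ← h _ hx', harc _ hx', hQP]

/-- Constant speed parametrizations of a unit speed curve. -/
lemma constant_speed {G T : ℝ → Plane} {L : ℝ} (hL : 0 < L) (hG : ∀ s, HasDerivAt G (T s) s)
    (hT1 : ∀ s ∈ Icc 0 L, ‖T s‖ = 1) :
    (∀ x ∈ Icc (0 : ℝ) 1, derivWithin (fun x => G (L * x)) (Icc 0 1) x = L • T (L * x)) ∧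
    curveLength (fun x => G (L * x)) = L ∧
    ∀ s ∈ Icc 0 L, arcParam (fun x => G (L * x)) s = G s := by
  have hmem : ∀ x ∈ Icc (0 : ℝ) 1, L * x ∈ Icc 0 L := fun x hx =>
    ⟨mul_nonneg hL.le hx.1, mul_le_of_le_one_right hL.le hx.2⟩
  have hd : ∀ x ∈ Icc (0 : ℝ) 1,
      derivWithin (fun x => G (L * x)) (Icc 0 1) x = L • T (L * x) := fun x hx => by
    have h := (hG (L * x)).scomp x ((hasDerivAt_id x).const_mul L)
    rw [mul_one] at h
    exact h.hasDerivWithinAt.derivWithin (uniqueDiffOn_Icc zero_lt_one x hx)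
  have harc : ∀ x ∈ Icc (0 : ℝ) 1, arclength (fun x => G (L * x)) x = L * x := fun x hx => by
    have : ∀ y ∈ uIcc 0 x, ‖derivWithin (fun x => G (L * x)) (Icc 0 1) y‖ = L := fun y hy => by
      rw [uIcc_of_le hx.1] at hy
      have hy' : y ∈ Icc (0 : ℝ) 1 := ⟨hy.1, hy.2.trans hx.2⟩
      rw [hd y hy', norm_smul, hT1 _ (hmem y hy'), mul_one, Real.norm_of_nonneg hL.le]
    rw [arclength, intervalIntegral.integral_congr this]
    simp [mul_comm]
  have hlen : curveLength (fun x => G (L * x)) = L := by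
    rw [curveLength, harc 1 (by simp), mul_one]
  refine ⟨hd, hlen, fun s hs => ?_⟩
  have hex : ∃ x ∈ Icc (0 : ℝ) 1, arclength (fun x => G (L * x)) x = s := by
    have hm : s / L ∈ Icc (0 : ℝ) 1 := ⟨div_nonneg hs.1 hL.le, div_le_one_of_le₀ hs.2 hL.le⟩
    exact ⟨s / L, hm, by rw [harc _ hm, mul_div_cancel₀ _ hL.ne']⟩
  have heq := Function.invFunOn_eq hex
  rw [harc _ (Function.invFunOn_mem hex)] at heq
  simp only [arcParam, heq]

lemma signedCurvature_eq {γ G T : ℝ → Plane} {T' : Plane} {L s : ℝ} (hs : s ∈ Ioo 0 L)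
    (h : ∀ t ∈ Ioo 0 L, arcParam γ t = G t) (hG : ∀ t ∈ Ioo 0 L, HasDerivAt G (T t) t)
    (hT : HasDerivAt T T' s) :
    signedCurvature γ s = T s 0 * T' 1 - T s 1 * T' 0 := by
  have ht : ∀ t ∈ Ioo 0 L, unitTangent γ t = T t := fun t ht => by
    refine ((hG t ht).congr_of_eventuallyEq ?_).deriv
    filter_upwards [Ioo_mem_nhds ht.1 ht.2] with r hr using h r hr
  have hd : deriv (unitTangent γ) s = T' := by
    refine (hT.congr_of_eventuallyEq ?_).deriv
    filter_upwards [Ioo_mem_nhds hs.1 hs.2] with r hr using ht r hr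
  rw [signedCurvature, hd, unitNormal, ht s hs]
  simp [PiLp.inner_apply, Fin.sum_univ_two]
  ring

/-! ### Free elasticae starting at an inflection point -/

lemma eq_left_of_hasDerivAt_zero {f : ℝ → ℝ} {a b : ℝ} (hf : ContinuousOn f (Icc a b))
    (h : ∀ x ∈ Ioo a b, HasDerivAt f 0 x) {x : ℝ} (hx : x ∈ Icc a b) : f x = f a := by
  have hd : ∀ x ∈ interior (Icc a b), HasDerivWithinAt f 0 (interior (Icc a b)) x := fun x hx => by
    rw [interior_Icc] at hx
    exact (h x hx).hasDerivWithinAt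
  have ha : a ∈ Icc a b := ⟨le_rfl, hx.1.trans hx.2⟩
  exact le_antisymm
    (antitoneOn_of_hasDerivWithinAt_nonpos (convex_Icc a b) hf hd (fun _ _ => le_rfl) ha hx hx.1)
    (monotoneOn_of_hasDerivWithinAt_nonneg (convex_Icc a b) hf hd (fun _ _ => le_rfl) ha hx hx.1)

lemma eq_on_Ioo_of_hasDerivAt_zero {f : ℝ → ℝ} {a b : ℝ}
    (h : ∀ x ∈ Ioo a b, HasDerivAt f 0 x) {x y : ℝ} (hx : x ∈ Ioo a b) (hy : y ∈ Ioo a b) :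
    f x = f y := by
  refine isOpen_Ioo.is_const_of_deriv_eq_zero isPreconnected_Ioo
    (fun z hz => (h z hz).differentiableAt.differentiableWithinAt) (fun z hz => ?_) hx hy
  exact (h z hz).deriv

/-- A nonnegative function with `D' ≤ C D` that tends to zero at the left end of an interval
vanishes there. -/
lemma eq_zero_of_deriv_le {D D' : ℝ → ℝ} {b C : ℝ} (hD : ∀ s ∈ Ioo 0 b, HasDerivAt D (D' s) s)
    (hle : ∀ s ∈ Ioo 0 b, D' s ≤ C * D s) (h0 : ∀ s, 0 ≤ D s)
    (hlim : Tendsto D (𝓝[>] 0) (𝓝 0)) {s : ℝ} (hs : s ∈ Ioo 0 b) : D s = 0 := by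
  have hE : ∀ s ∈ Ioo 0 b, HasDerivAt (fun s => D s * Real.exp (-C * s))
      ((D' s - C * D s) * Real.exp (-C * s)) s := fun s hs => by
    have h := (hD s hs).mul (((hasDerivAt_id s).const_mul (-C)).exp)
    exact h.congr_deriv (by simp only [id]; ring)
  have hanti : AntitoneOn (fun s => D s * Real.exp (-C * s)) (Ioo 0 b) := by
    refine antitoneOn_of_hasDerivWithinAt_nonpos (convex_Ioo 0 b)
      (f' := fun s => (D' s - C * D s) * Real.exp (-C * s))
      (fun t ht => (hE t ht).continuousAt.continuousWithinAt) (fun t ht => ?_) fun t ht => ?_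
    · rw [interior_Ioo] at ht
      exact (hE t ht).hasDerivWithinAt
    · rw [interior_Ioo] at ht
      exact mul_nonpos_of_nonpos_of_nonneg (by linarith [hle t ht]) (Real.exp_pos _).le
  have hl : Tendsto (fun s => D s * Real.exp (-C * s)) (𝓝[>] 0) (𝓝 0) := by
    have h1 : Tendsto (fun s => Real.exp (-C * s)) (𝓝[>] 0) (𝓝 (Real.exp (-C * 0))) :=
      (Continuous.tendsto (by fun_prop) 0).mono_left nhdsWithin_le_nhds
    simpa using hlim.mul h1
  have h1 : D s * Real.exp (-C * s) ≤ 0 := by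
    refine ge_of_tendsto hl ?_
    filter_upwards [Ioo_mem_nhdsGT hs.1] with t ht
    exact hanti ⟨ht.1, ht.2.trans hs.2⟩ hs ht.2.le
  exact le_antisymm (nonpos_of_mul_nonpos_left h1 (Real.exp_pos _)) (h0 s)

lemma hasDerivAt_scaled {f f' : ℝ → ℝ} (hf : ∀ t, HasDerivAt f (f' t) t) (r s : ℝ) :
    HasDerivAt (fun s => f (r * s)) (r * f' (r * s)) s := by
  have h := (hf (r * s)).comp s ((hasDerivAt_id s).const_mul r)
  rw [mul_one] at h
  exact h.congr_deriv (by ring)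

lemma rectY_sq_le (t : ℝ) : rectY t ^ 2 ≤ 2 := by
  have := rectS_sq_add t
  nlinarith [sq_nonneg (rectS t), sq_nonneg (rectY t ^ 2 - 2), sq_nonneg (rectY t)]

/-- A negative solution of `2k'' + k³ = 0` that vanishes at `0` is the curvature of a rectangular
elastica. -/
lemma elastica_curvature {k k' : ℝ → ℝ} {b : ℝ} (hb : 0 < b)
    (hk : ∀ s ∈ Ioo 0 b, HasDerivAt k (k' s) s)
    (hk' : ∀ s ∈ Ioo 0 b, HasDerivAt k' (-(k s ^ 3 / 2)) s)
    (h0 : Tendsto k (𝓝[>] 0) (𝓝 0)) (hneg : ∀ s ∈ Ioo 0 b, k s < 0) :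
    ∃ r > 0, ∀ s ∈ Ioo 0 b, k s = -r * rectY (r * s) := by
  have hmid : b / 2 ∈ Ioo 0 b := ⟨by linarith, by linarith⟩
  set e := k' (b / 2) ^ 2 + k (b / 2) ^ 4 / 4
  have he : ∀ s ∈ Ioo 0 b, k' s ^ 2 + k s ^ 4 / 4 = e := fun s hs => by
    refine eq_on_Ioo_of_hasDerivAt_zero (f := fun s => k' s ^ 2 + k s ^ 4 / 4) (fun t ht => ?_)
      hs hmid
    refine (((hk' t ht).pow 2).add (((hk t ht).pow 4).div_const 4)).congr_deriv ?_
    push_cast; ring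
  have hepos : 0 < e := by
    have := (hneg _ hmid).ne
    have : 0 < k (b / 2) ^ 4 := by positivity
    have := sq_nonneg (k' (b / 2))
    simp only [e]; linarith
  -- The model `-r * rectY (r * s)` has energy `r⁴`, which determines the scale.
  obtain ⟨r, hr, hre⟩ : ∃ r > 0, r ^ 4 = e := by
    refine ⟨√(√e), by positivity, ?_⟩
    rw [show 4 = 2 * 2 by norm_num, pow_mul, Real.sq_sqrt (by positivity), Real.sq_sqrt hepos.le]
  have hlim4 : Tendsto (fun s => e - k s ^ 4 / 4) (𝓝[>] 0) (𝓝 e) := by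
    simpa using ((h0.pow 4).div_const 4).const_sub e
  obtain ⟨δ, hδ, hδb⟩ : ∃ δ ∈ Ioo 0 b, ∀ s ∈ Ioo 0 δ, 0 < e - k s ^ 4 / 4 := by
    have h1 := hlim4.eventually_const_lt hepos
    obtain ⟨u, hu, hus⟩ := (mem_nhdsGT_iff_exists_Ioo_subset (a := (0 : ℝ))).1 h1
    refine ⟨min u (b / 2), ⟨lt_min hu hmid.1, (min_le_right _ _).trans_lt hmid.2⟩, fun s hs => ?_⟩
    exact hus ⟨hs.1, hs.2.trans_le (min_le_left _ _)⟩
  have hsub : Ioo 0 δ ⊆ Ioo 0 b := Ioo_subset_Ioo_right hδ.2.le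
  have hne : ∀ s ∈ Ioo 0 δ, k' s ≠ 0 := fun s hs h => by
    have := he s (hsub hs)
    have := hδb s hs
    rw [h] at *
    linarith
  -- Near `0` the energy keeps `k'` away from zero, so it has one sign; a positive sign would make
  -- `k` increase from its limit `0`, against `k < 0`.
  have hsign : ∀ s ∈ Ioo 0 δ, k' s < 0 := by
    by_contra! hc
    obtain ⟨s₀, hs₀, hge⟩ := hc
    have hpos : ∀ s ∈ Ioo 0 δ, 0 < k' s := by
      intro s hs
      by_contra! hle
      have himg := isPreconnected_Ioo.intermediate_value hs hs₀
        (f := k') (fun t ht => (hk' t (hsub ht)).continuousAt.continuousWithinAt)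
      obtain ⟨t, ht, hkt⟩ := himg ⟨hle, hge⟩
      exact hne t ht hkt
    have hmono : MonotoneOn k (Ioo 0 δ) := by
      refine monotoneOn_of_hasDerivWithinAt_nonneg (convex_Ioo 0 δ) (f' := k')
        (fun t ht => (hk t (hsub ht)).continuousAt.continuousWithinAt) (fun t ht => ?_)
        fun t ht => ?_
      · rw [interior_Ioo] at ht
        exact (hk t (hsub ht)).hasDerivWithinAt
      · rw [interior_Ioo] at ht
        exact (hpos t ht).le
    have : 0 ≤ k s₀ := by
      refine le_of_tendsto h0 ?_
      filter_upwards [Ioo_mem_nhdsGT hs₀.1] with t ht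
      exact hmono ⟨ht.1, ht.2.trans hs₀.2⟩ hs₀ ht.2.le
    exact absurd (hneg s₀ (hsub hs₀)) (not_lt.2 this)
  -- Energy and sign together determine the missing initial datum, which is that of the model.
  have hk'lim : Tendsto k' (𝓝[>] 0) (𝓝 (-r ^ 2)) := by
    have h1 : Tendsto (fun s => -√(e - k s ^ 4 / 4)) (𝓝[>] 0) (𝓝 (-√e)) :=
      ((Real.continuous_sqrt.tendsto e).comp hlim4).neg
    rw [← hre, show r ^ 4 = (r ^ 2) ^ 2 by ring, Real.sqrt_sq (by positivity)] at h1
    refine h1.congr' ?_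
    filter_upwards [Ioo_mem_nhdsGT hδ.1] with s hs
    have h2 : r ^ 4 - k s ^ 4 / 4 = (-k' s) ^ 2 := by rw [hre, ← he s (hsub hs)]; ring
    rw [show (r ^ 2) ^ 2 = r ^ 4 by ring, h2, Real.sqrt_sq (by linarith [hsign s hs]), neg_neg]
  have hm : ∀ s, HasDerivAt (fun s => -r * rectY (r * s)) (-r ^ 2 * rectS (r * s)) s := fun s =>
    ((hasDerivAt_scaled hasDerivAt_rectY r s).const_mul (-r)).congr_deriv (by ring)
  have hm' : ∀ s, HasDerivAt (fun s => -r ^ 2 * rectS (r * s))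
      (-((-r * rectY (r * s)) ^ 3 / 2)) s := fun s =>
    ((hasDerivAt_scaled hasDerivAt_rectS r s).const_mul (-r ^ 2)).congr_deriv (by ring)
  have hmlim : Tendsto (fun s => -r * rectY (r * s)) (𝓝[>] 0) (𝓝 0) := by
    have h := (hm 0).continuousAt.tendsto.mono_left (nhdsWithin_le_nhds (s := Ioi 0))
    simpa [rectY_zero] using h
  have hmlim' : Tendsto (fun s => -r ^ 2 * rectS (r * s)) (𝓝[>] 0) (𝓝 (-r ^ 2)) := by
    have h := (hm' 0).continuousAt.tendsto.mono_left (nhdsWithin_le_nhds (s := Ioi 0))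
    simpa [rectS_zero] using h
  have hDlim : Tendsto (fun s => (k s - -r * rectY (r * s)) ^ 2 +
      (k' s - -r ^ 2 * rectS (r * s)) ^ 2) (𝓝[>] 0) (𝓝 0) := by
    simpa using ((h0.sub hmlim).pow 2).add ((hk'lim.sub hmlim').pow 2)
  refine ⟨r, hr, fun s hs => ?_⟩
  -- With `m` the model, the squared distance has derivative `(k - m)(k' - m')(2 - (k² + km + m²))`.
  -- The energy gives `k², m² ≤ 2r²`, so the last factor is at most `2 + 6r²` in absolute value, and
  -- `C` is half of that.
  have hD := eq_zero_of_deriv_le (C := 1 + 3 * r ^ 2) (b := b)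
    (D := fun s => (k s - -r * rectY (r * s)) ^ 2 + (k' s - -r ^ 2 * rectS (r * s)) ^ 2)
    (fun t ht => (((hk t ht).sub (hm t)).pow 2).add (((hk' t ht).sub (hm' t)).pow 2))
    (fun t ht => ?_) (fun t => by positivity) hDlim hs
  · have h1 := sq_nonneg (k' s - -r ^ 2 * rectS (r * s))
    have h2 : k s - -r * rectY (r * s) = 0 := by
      have := sq_nonneg (k s - -r * rectY (r * s))
      exact pow_eq_zero_iff two_ne_zero |>.1 (by linarith)
    linarith
  · have hmb : (-r * rectY (r * t)) ^ 2 ≤ 2 * r ^ 2 := by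
      nlinarith [rectY_sq_le (r * t), sq_nonneg r]
    have hkb : k t ^ 2 ≤ 2 * r ^ 2 := by
      have h4 : (k t ^ 2) ^ 2 ≤ (2 * r ^ 2) ^ 2 := by
        have := he t ht
        rw [← hre] at this
        nlinarith [sq_nonneg (k' t)]
      exact le_of_sq_le_sq h4 (by positivity)
    simp only [Pi.sub_apply]
    generalize -r * rectY (r * t) = m at *
    generalize -r ^ 2 * rectS (r * t) = m' at *
    have hb1 : |2 - (k t ^ 2 + k t * m + m ^ 2)| ≤ 2 + 6 * r ^ 2 := by
      rw [abs_le]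
      constructor <;> nlinarith [sq_nonneg (k t + m), sq_nonneg (k t - m)]
    have hb2 : |(k t - m) * (k' t - m')| ≤ ((k t - m) ^ 2 + (k' t - m') ^ 2) / 2 := by
      rw [abs_le]
      constructor <;>
        nlinarith [sq_nonneg (k t - m + (k' t - m')), sq_nonneg (k t - m - (k' t - m'))]
    have hb3 := mul_le_mul hb2 hb1 (abs_nonneg _) (by positivity)
    rw [← abs_mul] at hb3
    have hb4 := le_abs_self ((k t - m) * (k' t - m') * (2 - (k t ^ 2 + k t * m + m ^ 2)))
    push_cast
    nlinarith

/-- A unit speed curve issuing from the origin whose curvature is that of a rectangular elastica is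
a rotated rectangular elastica. -/
lemma elastica_curve {x y p q : ℝ → ℝ} {b r : ℝ}
    (hx : ∀ s ∈ Ioo 0 b, HasDerivAt x (p s) s) (hy : ∀ s ∈ Ioo 0 b, HasDerivAt y (q s) s)
    (hp : ∀ s ∈ Ioo 0 b, HasDerivAt p (r * rectY (r * s) * q s) s)
    (hq : ∀ s ∈ Ioo 0 b, HasDerivAt q (-(r * rectY (r * s) * p s)) s)
    (cx : ContinuousOn x (Icc 0 b)) (cy : ContinuousOn y (Icc 0 b))
    (cp : ContinuousOn p (Icc 0 b)) (cq : ContinuousOn q (Icc 0 b))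
    (x0 : x 0 = 0) (y0 : y 0 = 0) :
    ∃ A B : ℝ, ∀ s ∈ Icc 0 b,
      p s = A * (rectY (r * s) ^ 2 / 2) - B * rectS (r * s) ∧
      q s = B * (rectY (r * s) ^ 2 / 2) + A * rectS (r * s) ∧
      r * x s = A * rectX (r * s) - B * rectY (r * s) ∧
      r * y s = B * rectX (r * s) + A * rectY (r * s) := by
  have hX := hasDerivAt_scaled hasDerivAt_rectX r
  have hY := hasDerivAt_scaled hasDerivAt_rectY r
  have hS := hasDerivAt_scaled hasDerivAt_rectS r
  have cX : Continuous fun s => rectX (r * s) := continuous_rectX.comp (by fun_prop)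
  have cY : Continuous fun s => rectY (r * s) := continuous_rectY.comp (by fun_prop)
  have cS : Continuous fun s => rectS (r * s) := continuous_rectS.comp (by fun_prop)
  -- The tangents of the curve and of the model turn at the same rate, so their inner product and
  -- their determinant are constant. Since the model starts in direction `(0, 1)`, these constants
  -- are `q 0` and `-p 0`.
  have hA : ∀ s ∈ Icc 0 b, p s * (rectY (r * s) ^ 2 / 2) + q s * rectS (r * s) =
      q 0 := fun s hs => by
    have := eq_left_of_hasDerivAt_zero
      (f := fun s => p s * (rectY (r * s) ^ 2 / 2) + q s * rectS (r * s)) (a := 0) (b := b)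
      ((cp.mul ((cY.pow 2).div_const 2).continuousOn).add (cq.mul cS.continuousOn))
      (fun t ht => (((hp t ht).mul (((hY t).pow 2).div_const 2)).add
        ((hq t ht).mul (hS t))).congr_deriv (by simp only [Pi.pow_apply]; push_cast; ring)) hs
    simpa [rectY_zero, rectS_zero] using this
  have hB : ∀ s ∈ Icc 0 b, q s * (rectY (r * s) ^ 2 / 2) - p s * rectS (r * s) =
      -p 0 := fun s hs => by
    have := eq_left_of_hasDerivAt_zero
      (f := fun s => q s * (rectY (r * s) ^ 2 / 2) - p s * rectS (r * s)) (a := 0) (b := b)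
      ((cq.mul ((cY.pow 2).div_const 2).continuousOn).sub (cp.mul cS.continuousOn))
      (fun t ht => (((hq t ht).mul (((hY t).pow 2).div_const 2)).sub
        ((hp t ht).mul (hS t))).congr_deriv (by simp only [Pi.pow_apply]; push_cast; ring)) hs
    simpa [rectY_zero, rectS_zero] using this
  have hps : ∀ s ∈ Icc 0 b, p s = q 0 * (rectY (r * s) ^ 2 / 2) - -p 0 * rectS (r * s) :=
    fun s hs => by
      rw [← hA s hs, ← hB s hs]
      linear_combination (-p s) * rectS_sq_add (r * s)
  have hqs : ∀ s ∈ Icc 0 b, q s = -p 0 * (rectY (r * s) ^ 2 / 2) + q 0 * rectS (r * s) :=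
    fun s hs => by
      rw [← hA s hs, ← hB s hs]
      linear_combination (-q s) * rectS_sq_add (r * s)
  refine ⟨q 0, -p 0, fun s hs => ⟨hps s hs, hqs s hs, ?_, ?_⟩⟩
  · have := eq_left_of_hasDerivAt_zero
      (f := fun s => r * x s - (q 0 * rectX (r * s) - -p 0 * rectY (r * s))) (a := 0) (b := b)
      ((cx.const_smul r).sub ((cX.const_mul _).sub (cY.const_mul _)).continuousOn)
      (fun t ht => (((hx t ht).const_mul r).sub (((hX t).const_mul _).sub
        ((hY t).const_mul _))).congr_deriv (by rw [hps t (Ioo_subset_Icc_self ht)]; ring)) hs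
    simp only [x0, mul_zero, rectX_zero, rectY_zero, sub_zero] at this
    linarith
  · have := eq_left_of_hasDerivAt_zero
      (f := fun s => r * y s - (-p 0 * rectX (r * s) + q 0 * rectY (r * s))) (a := 0) (b := b)
      ((cy.const_smul r).sub ((cX.const_mul _).add (cY.const_mul _)).continuousOn)
      (fun t ht => (((hy t ht).const_mul r).sub (((hX t).const_mul _).add
        ((hY t).const_mul _))).congr_deriv (by rw [hqs t (Ioo_subset_Icc_self ht)]; ring)) hs
    simp only [y0, mul_zero, rectX_zero, rectY_zero, add_zero] at this
    linarith

/-- If the rotated rectangular elastica ends with a horizontal tangent to the right of and above the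
origin, then its rescaled length solves the shooting problem. -/
lemma elastica_end {A B r b h p : ℝ} (hr : 0 < r) (hb : 0 < b) (hh : 0 < h)
    (hrb : r * b ≤ 2 * completeK qRect)
    (hp2 : p ^ 2 = 1) (hp : p = A * (rectY (r * b) ^ 2 / 2) - B * rectS (r * b))
    (hq : 0 = B * (rectY (r * b) ^ 2 / 2) + A * rectS (r * b))
    (hx : r * (1 / 2) = A * rectX (r * b) - B * rectY (r * b))
    (hy : r * h = B * rectX (r * b) + A * rectY (r * b)) :
    r * b ∈ Ioo 0 (2 * completeK qRect) ∧ 0 < shootH (r * b) ∧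
      shootV (r * b) = 2 * h * shootH (r * b) ∧ r = 2 * shootH (r * b) ∧
      A = rectY (r * b) ^ 2 / 2 ∧ B = -rectS (r * b) := by
  have hσ : 0 < r * b := by positivity
  set σ := r * b
  have hE := rectS_sq_add σ
  -- The final tangent is `(p, 0)`; inverting the rotation expresses `A` and `B` through `p`.
  have hA : A = p * (rectY σ ^ 2 / 2) := by
    linear_combination (-A) * hE - (rectY σ ^ 2 / 2) * hp - rectS σ * hq
  have hB : B = -(p * rectS σ) := by
    linear_combination (-B) * hE + rectS σ * hp - (rectY σ ^ 2 / 2) * hq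
  have hH : r * (1 / 2) = p * shootH σ := by
    rw [hx, hA, hB, shootH]; ring
  have hV : r * h = p * shootV σ := by
    rw [hy, hA, hB, shootV]; ring
  -- A final tangent pointing to the left would require `shootH` and `shootV` both negative.
  have hp1 : p = 1 := by
    have h0 : (p - 1) * (p + 1) = 0 := by linear_combination hp2
    rcases mul_eq_zero.1 h0 with h1 | h1
    · linarith
    · exfalso
      replace h1 : p = -1 := by linarith
      rw [h1] at hH hV
      have := shootV_nonneg_of_shootH_neg hσ.le hrb (by linarith)
      nlinarith [mul_pos hr hh]
  rw [hp1, one_mul] at hA hH hV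
  rw [hp1, one_mul] at hB
  have hHpos : 0 < shootH σ := by linarith
  refine ⟨⟨hσ, hrb.lt_of_ne fun h => ?_⟩, hHpos, ?_, by linarith, hA, hB⟩
  · rw [h, shootH_two_completeK] at hHpos
    exact hHpos.false
  · rw [← hV, show r = 2 * shootH σ by linarith]; ring

/-! ### The glued curve

For a parameter `σ` the arc `[0, σ]` of the rectangular elastica is rotated so that it ends with the
tangent `(1, 0)`, scaled by `1 / (2 * shootH σ)` and continued by reflection. -/

/-- Gluing of differentiable functions that agree to first order at a point. -/
lemma hasDerivAt_glue {E : Type*} [NormedAddCommGroup E] [NormedSpace ℝ E] {f g f' g' : ℝ → E}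
    {b : ℝ} (hf : ∀ s, HasDerivAt f (f' s) s) (hg : ∀ s, HasDerivAt g (g' s) s) (h : f b = g b)
    (h' : f' b = g' b) (s : ℝ) :
    HasDerivAt (fun s => if s ≤ b then f s else g s) (if s ≤ b then f' s else g' s) s := by
  rcases lt_trichotomy s b with hs | rfl | hs
  · rw [if_pos hs.le]
    refine (hf s).congr_of_eventuallyEq ?_
    filter_upwards [Iio_mem_nhds hs] with t ht using if_pos (le_of_lt ht)
  · rw [if_pos le_rfl]
    have h1 : HasDerivWithinAt (fun t => if t ≤ s then f t else g t) (f' s) (Iic s) s :=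
      (hf s).hasDerivWithinAt.congr (fun t ht => if_pos ht) (if_pos le_rfl)
    have h2 : HasDerivWithinAt (fun t => if t ≤ s then f t else g t) (f' s) (Ici s) s := by
      rw [h']
      refine (hg s).hasDerivWithinAt.congr (fun t ht => ?_) ((if_pos le_rfl).trans h)
      rcases (mem_Ici.1 ht).eq_or_lt with rfl | ht
      · exact (if_pos le_rfl).trans h
      · exact if_neg (not_le.2 ht)
    have h3 := h1.union h2
    rwa [Iic_union_Ici, hasDerivWithinAt_univ] at h3
  · rw [if_neg (not_le.2 hs)]
    refine (hg s).congr_of_eventuallyEq ?_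
    filter_upwards [Ioi_mem_nhds hs] with t ht using if_neg (not_le.2 ht)

/-- The scaling factor. -/
def scale (σ : ℝ) : ℝ := 2 * shootH σ

/-- Half the length of the glued curve. -/
def halfLength (σ : ℝ) : ℝ := σ / scale σ

/-- First coordinate of the left half. -/
def leftX (σ s : ℝ) : ℝ :=
  (rectY σ ^ 2 / 2 * rectX (scale σ * s) + rectS σ * rectY (scale σ * s)) / scale σ

/-- Second coordinate of the left half. -/
def leftY (σ s : ℝ) : ℝ :=
  (rectY σ ^ 2 / 2 * rectY (scale σ * s) - rectS σ * rectX (scale σ * s)) / scale σ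

/-- First component of the unit tangent of the left half. -/
def leftP (σ s : ℝ) : ℝ :=
  rectY σ ^ 2 / 2 * (rectY (scale σ * s) ^ 2 / 2) + rectS σ * rectS (scale σ * s)

/-- Second component of the unit tangent of the left half. -/
def leftQ (σ s : ℝ) : ℝ :=
  rectY σ ^ 2 / 2 * rectS (scale σ * s) - rectS σ * (rectY (scale σ * s) ^ 2 / 2)

/-- Absolute value of the curvature of the left half. -/
def leftK (σ s : ℝ) : ℝ := scale σ * rectY (scale σ * s)

/-- The glued curve, parametrized by arclength. -/
def gluedCurve (σ s : ℝ) : Plane :=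
  if s ≤ halfLength σ then !₂[leftX σ s, leftY σ s]
  else !₂[1 - leftX σ (2 * halfLength σ - s), leftY σ (2 * halfLength σ - s)]

/-- The unit tangent of the glued curve. -/
def gluedTangent (σ s : ℝ) : Plane :=
  if s ≤ halfLength σ then !₂[leftP σ s, leftQ σ s]
  else !₂[leftP σ (2 * halfLength σ - s), -leftQ σ (2 * halfLength σ - s)]

/-- The second derivative of the glued curve. -/
def gluedSecond (σ s : ℝ) : Plane :=
  if s ≤ halfLength σ then !₂[leftK σ s * leftQ σ s, -(leftK σ s * leftP σ s)]
  else !₂[-(leftK σ (2 * halfLength σ - s) * leftQ σ (2 * halfLength σ - s)),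
    -(leftK σ (2 * halfLength σ - s) * leftP σ (2 * halfLength σ - s))]

/-- `σ` is admissible for the shooting problem with target height `h`. -/
structure IsShooting (h σ : ℝ) : Prop where
  mem : σ ∈ Ioo 0 (2 * completeK qRect)
  pos : 0 < shootH σ
  slope : shootV σ = 2 * h * shootH σ

lemma leftP_sq_add (σ s : ℝ) : leftP σ s ^ 2 + leftQ σ s ^ 2 = 1 := by
  have h1 := rectS_sq_add σ
  have h2 := rectS_sq_add (scale σ * s)
  simp only [leftP, leftQ]
  linear_combination (rectS (scale σ * s) ^ 2 + rectY (scale σ * s) ^ 4 / 4) * h1 + h2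

section

variable {h σ : ℝ}

lemma IsShooting.scale_pos (H : IsShooting h σ) : 0 < scale σ := by
  have := H.pos
  simp only [scale]; positivity

lemma IsShooting.halfLength_pos (H : IsShooting h σ) : 0 < halfLength σ :=
  div_pos H.mem.1 H.scale_pos

lemma IsShooting.scale_mul (H : IsShooting h σ) : scale σ * halfLength σ = σ :=
  mul_div_cancel₀ _ H.scale_pos.ne'

lemma IsShooting.scaled_mem (H : IsShooting h σ) {s : ℝ} (hs : s ∈ Icc 0 (halfLength σ)) :
    scale σ * s ∈ Icc 0 σ := by
  refine ⟨mul_nonneg H.scale_pos.le hs.1, ?_⟩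
  conv_rhs => rw [← H.scale_mul]
  exact mul_le_mul_of_nonneg_left hs.2 H.scale_pos.le

lemma IsShooting.hasDerivAt_leftX (H : IsShooting h σ) (s : ℝ) :
    HasDerivAt (leftX σ) (leftP σ s) s := by
  have := H.scale_pos.ne'
  refine ((((hasDerivAt_scaled hasDerivAt_rectX (scale σ) s).const_mul _).add
    ((hasDerivAt_scaled hasDerivAt_rectY (scale σ) s).const_mul _)).div_const _).congr_deriv ?_
  simp only [leftP]; field_simp

lemma IsShooting.hasDerivAt_leftY (H : IsShooting h σ) (s : ℝ) :
    HasDerivAt (leftY σ) (leftQ σ s) s := by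
  have := H.scale_pos.ne'
  refine ((((hasDerivAt_scaled hasDerivAt_rectY (scale σ) s).const_mul _).sub
    ((hasDerivAt_scaled hasDerivAt_rectX (scale σ) s).const_mul _)).div_const _).congr_deriv ?_
  simp only [leftQ]; field_simp

lemma hasDerivAt_leftP (σ s : ℝ) : HasDerivAt (leftP σ) (leftK σ s * leftQ σ s) s := by
  refine ((((hasDerivAt_scaled hasDerivAt_rectY (scale σ) s).pow 2).div_const 2).const_mul _ |>.add
    ((hasDerivAt_scaled hasDerivAt_rectS (scale σ) s).const_mul _)).congr_deriv ?_
  simp only [leftQ, leftK]; push_cast; ring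

lemma hasDerivAt_leftQ (σ s : ℝ) : HasDerivAt (leftQ σ) (-(leftK σ s * leftP σ s)) s := by
  refine (((hasDerivAt_scaled hasDerivAt_rectS (scale σ) s).const_mul _).sub
    ((((hasDerivAt_scaled hasDerivAt_rectY (scale σ) s).pow 2).div_const
      2).const_mul _)).congr_deriv ?_
  simp only [leftP, leftK]; push_cast; ring

lemma continuous_leftK (σ : ℝ) : Continuous (leftK σ) :=
  continuous_const.mul (continuous_rectY.comp (continuous_const.mul continuous_id))

lemma leftX_zero (σ : ℝ) : leftX σ 0 = 0 := by simp [leftX, rectX_zero, rectY_zero]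

lemma leftY_zero (σ : ℝ) : leftY σ 0 = 0 := by simp [leftY, rectX_zero, rectY_zero]

lemma leftP_zero (σ : ℝ) : leftP σ 0 = rectS σ := by simp [leftP, rectS_zero, rectY_zero]

lemma IsShooting.leftX_end (H : IsShooting h σ) : leftX σ (halfLength σ) = 1 / 2 := by
  have h1 := H.scale_pos.ne'
  have h2 : rectY σ ^ 2 / 2 * rectX σ + rectS σ * rectY σ = scale σ / 2 := by
    simp only [scale, shootH]; ring
  rw [leftX, H.scale_mul, h2]; field_simp

lemma IsShooting.leftY_end (H : IsShooting h σ) : leftY σ (halfLength σ) = h := by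
  have h1 := H.scale_pos.ne'
  have h2 : rectY σ ^ 2 / 2 * rectY σ - rectS σ * rectX σ = h * scale σ := by
    have := H.slope
    simp only [shootV] at this
    simp only [scale]; linarith
  rw [leftY, H.scale_mul, h2]; field_simp

lemma IsShooting.leftQ_end (H : IsShooting h σ) : leftQ σ (halfLength σ) = 0 := by
  rw [leftQ, H.scale_mul]; ring

lemma hasDerivAt_reflect {f f' : ℝ → ℝ} (hf : ∀ s, HasDerivAt f (f' s) s) (L s : ℝ) :
    HasDerivAt (fun s => f (L - s)) (-f' (L - s)) s := by
  exact ((hf (L - s)).comp s ((hasDerivAt_id s).const_sub L)).congr_deriv (by simp)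

lemma IsShooting.hasDerivAt_gluedCurve (H : IsShooting h σ) (s : ℝ) :
    HasDerivAt (gluedCurve σ) (gluedTangent σ s) s := by
  have hb : 2 * halfLength σ - halfLength σ = halfLength σ := by ring
  refine hasDerivAt_glue (fun s => hasDerivAt_plane (H.hasDerivAt_leftX s) (H.hasDerivAt_leftY s))
    (g' := fun s => !₂[leftP σ (2 * halfLength σ - s), -leftQ σ (2 * halfLength σ - s)])
    (fun s => hasDerivAt_plane
      (((hasDerivAt_reflect H.hasDerivAt_leftX _ s).const_sub 1).congr_deriv (neg_neg _))
      (hasDerivAt_reflect H.hasDerivAt_leftY _ s)) ?_ ?_ s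
  · simp only [hb, H.leftX_end]; norm_num
  · simp only [hb, H.leftQ_end, neg_zero]

lemma IsShooting.hasDerivAt_gluedTangent (H : IsShooting h σ) (s : ℝ) :
    HasDerivAt (gluedTangent σ) (gluedSecond σ s) s := by
  have hb : 2 * halfLength σ - halfLength σ = halfLength σ := by ring
  refine hasDerivAt_glue (fun s => hasDerivAt_plane (hasDerivAt_leftP σ s) (hasDerivAt_leftQ σ s))
    (g' := fun s => !₂[-(leftK σ (2 * halfLength σ - s) * leftQ σ (2 * halfLength σ - s)),
      -(leftK σ (2 * halfLength σ - s) * leftP σ (2 * halfLength σ - s))])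
    (fun s => hasDerivAt_plane (b := fun s => -leftQ σ (2 * halfLength σ - s))
      (hasDerivAt_reflect (hasDerivAt_leftP σ) _ s)
      ((hasDerivAt_reflect (hasDerivAt_leftQ σ) _ s).neg.congr_deriv (by ring))) ?_ ?_ s
  · simp only [hb, H.leftQ_end, neg_zero]
  · simp only [hb, H.leftQ_end, mul_zero, neg_zero]

lemma continuous_plane {a b : ℝ → ℝ} (ha : Continuous a) (hb : Continuous b) :
    Continuous fun s => (!₂[a s, b s] : Plane) := by
  refine (PiLp.continuous_toLp 2 (fun _ : Fin 2 => ℝ)).comp (continuous_pi fun i => ?_)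
  fin_cases i
  · exact ha
  · exact hb

/-- Reflection changes only the sign of the first component, and that component vanishes at the tip
because the tangent is horizontal there. Thus the curve is `C²` although `k'` may jump. -/
lemma IsShooting.continuous_gluedSecond (H : IsShooting h σ) : Continuous (gluedSecond σ) := by
  have cP : Continuous (leftP σ) :=
    continuous_iff_continuousAt.2 fun s => (hasDerivAt_leftP σ s).continuousAt
  have cQ : Continuous (leftQ σ) :=
    continuous_iff_continuousAt.2 fun s => (hasDerivAt_leftQ σ s).continuousAt
  have cK := continuous_leftK σ
  refine Continuous.if_le (continuous_plane (by fun_prop) (by fun_prop))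
    (continuous_plane (by fun_prop) (by fun_prop)) continuous_id continuous_const fun s hs => ?_
  rw [hs, show 2 * halfLength σ - halfLength σ = halfLength σ by ring, H.leftQ_end]
  simp

lemma IsShooting.continuous_gluedTangent (H : IsShooting h σ) : Continuous (gluedTangent σ) :=
  continuous_iff_continuousAt.2 fun s => (H.hasDerivAt_gluedTangent s).continuousAt

lemma IsShooting.continuous_gluedCurve (H : IsShooting h σ) : Continuous (gluedCurve σ) :=
  continuous_iff_continuousAt.2 fun s => (H.hasDerivAt_gluedCurve s).continuousAt

lemma norm_gluedTangent (σ s : ℝ) : ‖gluedTangent σ s‖ = 1 := by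
  apply norm_plane_eq_one
  rw [gluedTangent]
  split_ifs
  · simpa using leftP_sq_add σ s
  · simpa using leftP_sq_add σ (2 * halfLength σ - s)

lemma gluedCurve_left {s : ℝ} (hs : s ≤ halfLength σ) :
    gluedCurve σ s = !₂[leftX σ s, leftY σ s] := if_pos hs

lemma gluedTangent_left {s : ℝ} (hs : s ≤ halfLength σ) :
    gluedTangent σ s = !₂[leftP σ s, leftQ σ s] := if_pos hs

lemma IsShooting.gluedCurve_right (H : IsShooting h σ) {s : ℝ} (hs : halfLength σ ≤ s) :
    gluedCurve σ s =
      !₂[1 - leftX σ (2 * halfLength σ - s), leftY σ (2 * halfLength σ - s)] := by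
  rcases hs.eq_or_lt with rfl | hs
  · rw [gluedCurve_left le_rfl, show 2 * halfLength σ - halfLength σ = halfLength σ by ring,
      H.leftX_end]
    norm_num
  · exact if_neg (not_le.2 hs)

lemma IsShooting.gluedTangent_right (H : IsShooting h σ) {s : ℝ} (hs : halfLength σ ≤ s) :
    gluedTangent σ s =
      !₂[leftP σ (2 * halfLength σ - s), -leftQ σ (2 * halfLength σ - s)] := by
  rcases hs.eq_or_lt with rfl | hs
  · rw [gluedTangent_left le_rfl, show 2 * halfLength σ - halfLength σ = halfLength σ by ring,
      H.leftQ_end]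
    norm_num
  · exact if_neg (not_le.2 hs)

lemma IsShooting.gluedCurve_symm (H : IsShooting h σ) (s : ℝ) :
    gluedCurve σ (2 * halfLength σ - s) = !₂[1 - gluedCurve σ s 0, gluedCurve σ s 1] := by
  rcases le_total s (halfLength σ) with hs | hs
  · rw [H.gluedCurve_right (by linarith), gluedCurve_left hs]
    simp
  · rw [gluedCurve_left (by linarith), H.gluedCurve_right hs]
    simp

lemma IsShooting.gluedCurve_zero (H : IsShooting h σ) : gluedCurve σ 0 = !₂[0, 0] := by
  rw [gluedCurve_left H.halfLength_pos.le, leftX_zero, leftY_zero]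

lemma IsShooting.gluedCurve_end (H : IsShooting h σ) :
    gluedCurve σ (2 * halfLength σ) = !₂[1, 0] := by
  have := H.gluedCurve_symm 0
  rw [sub_zero, H.gluedCurve_zero] at this
  simpa using this

lemma IsShooting.gluedCurve_tip (H : IsShooting h σ) :
    gluedCurve σ (halfLength σ) = !₂[1 / 2, h] := by
  rw [gluedCurve_left le_rfl, H.leftX_end, H.leftY_end]

/-- The curvature of a curve whose arclength parametrization is the glued curve. -/
lemma IsShooting.signedCurvature_eq (H : IsShooting h σ) {γ : ℝ → Plane}
    (hγ : ∀ s ∈ Icc 0 (2 * halfLength σ), arcParam γ s = gluedCurve σ s) {s : ℝ}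
    (hs : s ∈ Ioo 0 (2 * halfLength σ)) :
    signedCurvature γ s =
      -leftK σ (if s ≤ halfLength σ then s else 2 * halfLength σ - s) := by
  rw [ElasticObstacle.signedCurvature_eq hs (fun t ht => hγ t (Ioo_subset_Icc_self ht))
    (fun t _ => H.hasDerivAt_gluedCurve t) (H.hasDerivAt_gluedTangent s), gluedTangent, gluedSecond]
  split_ifs
  · have := leftP_sq_add σ s
    simp only [Matrix.cons_val_zero, Matrix.cons_val_one]
    linear_combination (-leftK σ s) * this
  · have := leftP_sq_add σ (2 * halfLength σ - s)
    simp only [Matrix.cons_val_zero, Matrix.cons_val_one]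
    linear_combination (-leftK σ (2 * halfLength σ - s)) * this

lemma IsShooting.signedCurvature_left (H : IsShooting h σ) {γ : ℝ → Plane}
    (hγ : ∀ s ∈ Icc 0 (2 * halfLength σ), arcParam γ s = gluedCurve σ s) {s : ℝ}
    (hs : s ∈ Ioo 0 (halfLength σ)) : signedCurvature γ s = -leftK σ s := by
  have := H.halfLength_pos
  rw [H.signedCurvature_eq hγ ⟨hs.1, by linarith [hs.2]⟩, if_pos hs.2.le]

lemma hasDerivAt_leftK (σ s : ℝ) :
    HasDerivAt (leftK σ) (scale σ ^ 2 * rectS (scale σ * s)) s :=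
  ((hasDerivAt_scaled hasDerivAt_rectY (scale σ) s).const_mul (scale σ)).congr_deriv (by ring)

lemma IsShooting.deriv_signedCurvature (H : IsShooting h σ) {γ : ℝ → Plane}
    (hγ : ∀ s ∈ Icc 0 (2 * halfLength σ), arcParam γ s = gluedCurve σ s) {s : ℝ}
    (hs : s ∈ Ioo 0 (halfLength σ)) :
    deriv (signedCurvature γ) s = -(scale σ ^ 2 * rectS (scale σ * s)) := by
  refine ((hasDerivAt_leftK σ s).neg.congr_of_eventuallyEq ?_).deriv
  filter_upwards [Ioo_mem_nhds hs.1 hs.2] with t ht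
  exact H.signedCurvature_left hγ ht

lemma IsShooting.tendsto_deriv_signedCurvature (H : IsShooting h σ) {γ : ℝ → Plane}
    (hγ : ∀ s ∈ Icc 0 (2 * halfLength σ), arcParam γ s = gluedCurve σ s) :
    Tendsto (deriv (signedCurvature γ)) (𝓝[<] (halfLength σ)) (𝓝 (-(scale σ ^ 2 * rectS σ))) := by
  have hc : Continuous fun s => -(scale σ ^ 2 * rectS (scale σ * s)) :=
    (continuous_const.mul (continuous_rectS.comp (by fun_prop))).neg
  have h1 := (hc.tendsto (halfLength σ)).mono_left (nhdsWithin_le_nhds (s := Iio (halfLength σ)))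
  rw [H.scale_mul] at h1
  refine h1.congr' ?_
  filter_upwards [Ioo_mem_nhdsLT H.halfLength_pos] with s hs
  exact (H.deriv_signedCurvature hγ hs).symm

end

/-! ### Symmetric cut-and-glued free elasticae are glued curves -/

lemma Admissible.contDiffOn {ψ : ℝ → ℝ} {γ : ℝ → Plane} (h : γ ∈ Admissible ψ) :
    ContDiffOn ℝ 1 γ (Icc 0 1) := h.1.contDiffOn

lemma ContinuousOn.plane_apply {f : ℝ → Plane} {S : Set ℝ} (h : ContinuousOn f S) (i : Fin 2) :
    ContinuousOn (fun s => f s i) S :=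
  (EuclideanSpace.proj (𝕜 := ℝ) i : Plane →L[ℝ] ℝ).continuous.comp_continuousOn h

/-- Frenet equations where the signed curvature does not vanish. -/
lemma frenet_of_signedCurvature_ne_zero {γ T : ℝ → Plane} {L : ℝ}
    (hT : ∀ s ∈ Ioo 0 L, HasDerivAt (arcParam γ) (T s) s) (hn : ∀ s ∈ Ioo 0 L, ‖T s‖ = 1)
    {s : ℝ} (hs : s ∈ Ioo 0 L) (hk : signedCurvature γ s ≠ 0) :
    HasDerivAt (fun s => T s 0) (-(signedCurvature γ s * T s 1)) s ∧
      HasDerivAt (fun s => T s 1) (signedCurvature γ s * T s 0) s := by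
  have hu : ∀ t ∈ Ioo 0 L, unitTangent γ t = T t := fun t ht => (hT t ht).deriv
  have hev : T =ᶠ[𝓝 s] unitTangent γ := by
    filter_upwards [Ioo_mem_nhds hs.1 hs.2] with t ht using (hu t ht).symm
  -- Where the tangent is not differentiable, `deriv` and with it the signed curvature would be zero
  -- by convention.
  have hdiff : DifferentiableAt ℝ (unitTangent γ) s := by
    by_contra hc
    exact hk (by rw [signedCurvature, deriv_zero_of_not_differentiableAt hc, inner_zero_left])
  have hT' := hdiff.hasDerivAt.congr_of_eventuallyEq hev
  have hK := signedCurvature_eq hs (fun t _ => rfl) hT hT'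
  have h0 := HasDerivAt.plane_apply hT' 0
  have h1 := HasDerivAt.plane_apply hT' 1
  have horth : T s 0 * deriv (unitTangent γ) s 0 + T s 1 * deriv (unitTangent γ) s 1 = 0 := by
    have hc : HasDerivAt (fun t => T t 0 ^ 2 + T t 1 ^ 2) 0 s := by
      refine (hasDerivAt_const s (1 : ℝ)).congr_of_eventuallyEq ?_
      filter_upwards [Ioo_mem_nhds hs.1 hs.2] with t ht
      rw [← norm_sq_plane, hn t ht, one_pow]
    have := hc.unique ((h0.pow 2).add (h1.pow 2))
    push_cast at this
    linarith
  have hone : T s 0 ^ 2 + T s 1 ^ 2 = 1 := by rw [← norm_sq_plane, hn s hs, one_pow]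
  refine ⟨h0.congr_deriv ?_, h1.congr_deriv ?_⟩
  · rw [hK]
    linear_combination (-(deriv (unitTangent γ) s 0)) * hone + T s 0 * horth
  · rw [hK]
    linear_combination (-(deriv (unitTangent γ) s 1)) * hone + T s 1 * horth

/-- Every SCF is a glued curve whose parameter solves the shooting problem. -/
theorem IsSCF.exists_shooting {ψ : ℝ → ℝ} {γ : ℝ → Plane} (hγ : IsSCF ψ γ)
    (hh : 0 < ψ (1 / 2)) :
    ∃ σ, IsShooting (ψ (1 / 2)) σ ∧ curveLength γ = 2 * halfLength σ ∧
      ∀ s ∈ Icc 0 (curveLength γ), arcParam γ s = gluedCurve σ s := by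
  have h1 := Admissible.contDiffOn hγ.mem
  have h2 := hγ.mem.2.1
  obtain ⟨T, hTc, hT, hTn, hac, ha0⟩ := exists_unitTangent h1 h2
  have hL := curveLength_pos h1 h2
  set L := curveLength γ with hLdef
  set b := L / 2 with hbdef
  have hb : 0 < b := by positivity
  have hLb : L = 2 * b := by rw [hbdef]; ring
  have hsub : Ioo 0 b ⊆ Ioo 0 L := Ioo_subset_Ioo_right (by linarith)
  have hsubc : Icc 0 b ⊆ Icc 0 L := Icc_subset_Icc_right (by linarith)
  have hbL : b ∈ Ioo 0 L := ⟨hb, by linarith⟩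
  have hfr := fun s (hs : s ∈ Ioo 0 b) => frenet_of_signedCurvature_ne_zero hT
    (fun t ht => hTn t (Ioo_subset_Icc_self ht)) (hsub hs) (hγ.neg s hs).ne
  have hcd : ContDiffOn ℝ (1 + 1) (signedCurvature γ) (Ioo 0 b) := hγ.contDiffOn
  obtain ⟨hd1, -, hcd1⟩ := (contDiffOn_succ_iff_deriv_of_isOpen isOpen_Ioo).1 hcd
  obtain ⟨r, hr, hkr⟩ := elastica_curvature hb
    (fun s hs => (hd1.differentiableAt (isOpen_Ioo.mem_nhds hs)).hasDerivAt)
    (fun s hs => ((hcd1.differentiableOn one_ne_zero).differentiableAt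
      (isOpen_Ioo.mem_nhds hs)).hasDerivAt.congr_deriv (by linarith [hγ.elastica s hs]))
    hγ.zero hγ.neg
  -- A longer arc would contain the next inflection `2K / r`, where `k` vanishes.
  have hrb : r * b ≤ 2 * completeK qRect := by
    by_contra! hc
    have hK := completeK_pos
    have hm : 2 * completeK qRect / r ∈ Ioo 0 b :=
      ⟨by positivity, by rw [div_lt_iff₀ hr]; linarith⟩
    have h3 := hγ.neg _ hm
    rw [hkr _ hm, mul_div_cancel₀ _ hr.ne', rectY_two_completeK, mul_zero] at h3
    exact h3.false
  obtain ⟨A, B, hAB⟩ := elastica_curve (r := r)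
    (fun s hs => HasDerivAt.plane_apply (hT s (hsub hs)) 0)
    (fun s hs => HasDerivAt.plane_apply (hT s (hsub hs)) 1)
    (fun s hs => (hfr s hs).1.congr_deriv (by rw [hkr s hs]; ring))
    (fun s hs => (hfr s hs).2.congr_deriv (by rw [hkr s hs]; ring))
    (ContinuousOn.plane_apply (hac.mono hsubc) 0) (ContinuousOn.plane_apply (hac.mono hsubc) 1)
    (ContinuousOn.plane_apply (hTc.mono hsubc) 0) (ContinuousOn.plane_apply (hTc.mono hsubc) 1)
    (by rw [ha0, hγ.mem.2.2.1]; rfl) (by rw [ha0, hγ.mem.2.2.1]; rfl)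
  -- The height is even about the midpoint, so its derivative there equals its own negative.
  have hTb1 : T b 1 = 0 := by
    have hy := HasDerivAt.plane_apply (hT b hbL) 1
    have hyr : HasDerivAt (fun s => arcParam γ (L - s) 1) (-T b 1) b := by
      have hb' : L - b = b := by linarith
      have := HasDerivAt.comp_const_sub (f := fun s => arcParam γ s 1) L b (by rw [hb']; exact hy)
      exact this
    have hyy : HasDerivAt (fun s => arcParam γ (L - s) 1) (T b 1) b := by
      refine hy.congr_of_eventuallyEq ?_
      filter_upwards [Ioo_mem_nhds hbL.1 hbL.2] with t ht
      rw [hγ.symm t (Ioo_subset_Icc_self ht)]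
      rfl
    have := hyr.unique hyy
    linarith
  have hTb0 : T b 0 ^ 2 = 1 := by
    have := norm_sq_plane (T b)
    rw [hTn b (Ioo_subset_Icc_self hbL), hTb1] at this
    linarith
  obtain ⟨e1, e2, e3, e4⟩ := hAB b ⟨hb.le, le_rfl⟩
  rw [hTb1] at e2
  rw [hγ.tip] at e3 e4
  obtain ⟨hmem, hpos, hslope, hrs, hA, hB⟩ :=
    elastica_end hr hb hh hrb hTb0 e1 e2 (by simpa using e3) (by simpa using e4)
  set σ := r * b with hσ
  have H : IsShooting (ψ (1 / 2)) σ := ⟨hmem, hpos, hslope⟩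
  have hsc : scale σ = r := hrs.symm
  have hbl : halfLength σ = b := by rw [halfLength, hsc, hσ, mul_div_cancel_left₀ _ hr.ne']
  have hleft : ∀ s ∈ Icc 0 b, arcParam γ s = !₂[leftX σ s, leftY σ s] := fun s hs => by
    obtain ⟨-, -, h3, h4⟩ := hAB s hs
    apply plane_ext
    · change arcParam γ s 0 = leftX σ s
      rw [leftX, hsc, eq_div_iff hr.ne', mul_comm, h3, hA, hB]; ring
    · change arcParam γ s 1 = leftY σ s
      rw [leftY, hsc, eq_div_iff hr.ne', mul_comm, h4, hA, hB]; ring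
  refine ⟨σ, H, by rw [hbl, hLb], fun s hs => ?_⟩
  rcases le_total s b with hsb | hsb
  · rw [hleft s ⟨hs.1, hsb⟩, gluedCurve_left (by rwa [hbl])]
  · have hm : L - s ∈ Icc 0 b := ⟨by linarith [hs.2], by linarith⟩
    have h3 := hγ.symm (L - s) (hsubc hm)
    rw [← hLdef, sub_sub_cancel] at h3
    rw [h3, hleft _ hm, H.gluedCurve_right (by rwa [hbl]), hbl, ← hLb]
    rfl

/-! ### The glued curve lies above the cone -/

/-- On the left half an affine function that is negative at `0` and positive somewhere is
increasing; symmetry moves a positive point of the right half there. -/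
lemma IsSymmetricCone.tip_pos {ψ : ℝ → ℝ} (hψ : IsObstacle ψ) (hc : IsSymmetricCone ψ) :
    0 < ψ (1 / 2) := by
  obtain ⟨⟨a, b, hab⟩, hs⟩ := hc
  have key : ∀ x, 0 ≤ x → x ≤ 1 / 2 → 0 < ψ x → 0 < ψ (1 / 2) := fun x hx0 hx hp => by
    have h0 := hψ.neg_left 0 le_rfl
    rw [hab 0 (by norm_num)] at h0
    rw [hab x hx] at hp
    rw [hab _ le_rfl]
    nlinarith
  obtain ⟨x, hx, hp⟩ := hψ.max_pos
  rcases le_total x (1 / 2) with h | h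
  · exact key x hx.1 h hp
  · exact key (1 - x) (by linarith [hx.2]) (by linarith) (by rwa [← hs])

/-- A symmetric cone lies below the chord from the origin to its tip. -/
lemma IsSymmetricCone.le_chord {ψ : ℝ → ℝ} (hψ : IsObstacle ψ) (hc : IsSymmetricCone ψ) {x : ℝ}
    (hx : x ≤ 1 / 2) : ψ x ≤ 2 * ψ (1 / 2) * x := by
  obtain ⟨⟨a, b, hab⟩, -⟩ := hc
  have h0 := hψ.neg_left 0 le_rfl
  rw [hab 0 (by norm_num)] at h0
  rw [hab x hx, hab _ le_rfl]
  -- The two sides differ by `b (1 - 2x)`, and the intercept `b = ψ 0` is negative.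
  nlinarith

section

variable {h σ : ℝ}

lemma IsShooting.leftK_nonneg (H : IsShooting h σ) {s : ℝ} (hs : s ∈ Icc 0 (halfLength σ)) :
    0 ≤ leftK σ s := by
  have hm := H.scaled_mem hs
  exact mul_nonneg H.scale_pos.le (rectY_nonneg hm.1 (hm.2.trans H.mem.2.le))

/-- This is the sine of the angle from the final tangent of the arc to the current one. The tangent
turns clockwise from vertically up to at most vertically down, so the angle lies in `[0, π]`; the
case distinction on signs avoids introducing it. -/
lemma IsShooting.leftQ_nonneg (H : IsShooting h σ) {s : ℝ} (hs : s ∈ Icc 0 (halfLength σ)) :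
    0 ≤ leftQ σ s := by
  have hm := H.scaled_mem hs
  simp only [leftQ]
  set t := scale σ * s
  have hS : rectS σ ≤ rectS t := strictAntiOn_rectS.antitoneOn
    ⟨hm.1, hm.2.trans H.mem.2.le⟩ ⟨H.mem.1.le, H.mem.2.le⟩ hm.2
  have e1 := rectS_sq_add σ
  have e2 := rectS_sq_add t
  have n1 : 0 ≤ rectY σ ^ 2 / 2 := by positivity
  have n2 : 0 ≤ rectY t ^ 2 / 2 := by positivity
  rw [show rectY σ ^ 4 / 4 = (rectY σ ^ 2 / 2) ^ 2 by ring] at e1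
  rw [show rectY t ^ 4 / 4 = (rectY t ^ 2 / 2) ^ 2 by ring] at e2
  generalize rectY σ ^ 2 / 2 = c at *
  generalize rectY t ^ 2 / 2 = c' at *
  rcases le_total 0 (rectS σ) with h0 | h0
  · have hc : c' ≤ c := by
      refine le_of_sq_le_sq ?_ n1
      nlinarith
    nlinarith [mul_le_mul hS hc n2 (h0.trans hS)]
  · rcases le_total 0 (rectS t) with h1 | h1
    · nlinarith [mul_nonneg n1 h1, mul_nonneg (neg_nonneg.2 h0) n2]
    · have hc : c ≤ c' := by
        refine le_of_sq_le_sq ?_ n2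
        nlinarith
      nlinarith [mul_le_mul hc (neg_le_neg hS) (neg_nonneg.2 h1) n2]

lemma IsShooting.monotoneOn_leftP (H : IsShooting h σ) :
    MonotoneOn (leftP σ) (Icc 0 (halfLength σ)) := by
  refine monotoneOn_of_hasDerivWithinAt_nonneg (convex_Icc _ _)
    (fun s _ => (hasDerivAt_leftP σ s).continuousAt.continuousWithinAt)
    (fun s _ => (hasDerivAt_leftP σ s).hasDerivWithinAt) fun s hs => ?_
  have hs' := interior_subset hs
  exact mul_nonneg (H.leftK_nonneg hs') (H.leftQ_nonneg hs')

/-- Convexity bounds the abscissa by its end values `0` and `1/2`, which keeps the left half over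
the affine piece of the cone, even where the abscissa is negative. -/
lemma IsShooting.leftX_le (H : IsShooting h σ) {s : ℝ} (hs : s ∈ Icc 0 (halfLength σ)) :
    leftX σ s ≤ 1 / 2 := by
  have hb := H.halfLength_pos
  have hconv : ConvexOn ℝ (Icc 0 (halfLength σ)) (leftX σ) := by
    refine MonotoneOn.convexOn_of_deriv (convex_Icc _ _)
      (fun s _ => (H.hasDerivAt_leftX s).continuousAt.continuousWithinAt)
      (fun s _ => (H.hasDerivAt_leftX s).differentiableAt.differentiableWithinAt) ?_
    rw [show deriv (leftX σ) = leftP σ from funext fun s => (H.hasDerivAt_leftX s).deriv]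
    exact H.monotoneOn_leftP.mono interior_subset
  have := hconv.le_max_of_mem_Icc ⟨le_rfl, hb.le⟩ ⟨hb.le, le_rfl⟩ hs
  rw [leftX_zero, H.leftX_end] at this
  simpa using this

/-- The difference vanishes at both ends, so a negative value would give its derivative `Q - 2hP` a
negative value at some `t₁` and a positive one at a later `t₂`. But `Q ≥ 0` forces `P > 0` at `t₁`,
hence from `t₁` on since `P` is monotone, and there the derivative decreases. The detour is needed
because `P` may be negative near the start. -/
lemma IsShooting.chord_le (H : IsShooting h σ) (hh : 0 < h) {s : ℝ}
    (hs : s ∈ Icc 0 (halfLength σ)) : 2 * h * leftX σ s ≤ leftY σ s := by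
  have hd : ∀ s, HasDerivAt (fun s => leftY σ s - 2 * h * leftX σ s)
      (leftQ σ s - 2 * h * leftP σ s) s := fun s =>
    (H.hasDerivAt_leftY s).sub ((H.hasDerivAt_leftX s).const_mul _)
  have hd' : ∀ s, HasDerivAt (fun s => leftQ σ s - 2 * h * leftP σ s)
      (-(leftK σ s * (leftP σ s + 2 * h * leftQ σ s))) s := fun s =>
    ((hasDerivAt_leftQ σ s).sub ((hasDerivAt_leftP σ s).const_mul _)).congr_deriv (by ring)
  have hc : Continuous fun s => leftY σ s - 2 * h * leftX σ s :=
    continuous_iff_continuousAt.2 fun s => (hd s).continuousAt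
  by_contra! hlt
  have hs0 : 0 < s := hs.1.lt_of_ne fun h0 => by
    rw [← h0, leftX_zero, leftY_zero] at hlt; linarith
  have hsb : s < halfLength σ := hs.2.lt_of_ne fun h0 => by
    rw [h0, H.leftX_end, H.leftY_end] at hlt; linarith
  obtain ⟨t₁, ht₁, e₁⟩ := exists_hasDerivAt_eq_slope (fun s => leftY σ s - 2 * h * leftX σ s) _ hs0
    hc.continuousOn fun t _ => hd t
  obtain ⟨t₂, ht₂, e₂⟩ := exists_hasDerivAt_eq_slope (fun s => leftY σ s - 2 * h * leftX σ s) _ hsb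
    hc.continuousOn fun t _ => hd t
  have n₁ : leftQ σ t₁ - 2 * h * leftP σ t₁ < 0 := by
    rw [e₁]
    refine div_neg_of_neg_of_pos ?_ (by linarith)
    rw [leftX_zero, leftY_zero]; linarith
  have n₂ : 0 < leftQ σ t₂ - 2 * h * leftP σ t₂ := by
    rw [e₂]
    refine div_pos ?_ (by linarith)
    rw [H.leftX_end, H.leftY_end]; linarith
  have hm₁ : t₁ ∈ Icc 0 (halfLength σ) := ⟨ht₁.1.le, by linarith [ht₁.2]⟩
  have hP₁ : 0 < leftP σ t₁ := by
    have := H.leftQ_nonneg hm₁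
    by_contra! hle
    nlinarith
  have hsub : Icc t₁ (halfLength σ) ⊆ Icc 0 (halfLength σ) := Icc_subset_Icc_left hm₁.1
  have hanti : AntitoneOn (fun s => leftQ σ s - 2 * h * leftP σ s) (Icc t₁ (halfLength σ)) := by
    refine antitoneOn_of_hasDerivWithinAt_nonpos (convex_Icc _ _)
      (fun s _ => (hd' s).continuousAt.continuousWithinAt)
      (fun s _ => (hd' s).hasDerivWithinAt) fun t ht => ?_
    have ht' := interior_subset ht
    have hP := hP₁.le.trans (H.monotoneOn_leftP hm₁ (hsub ht') ht'.1)
    have hQ := H.leftQ_nonneg (hsub ht')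
    have hK := H.leftK_nonneg (hsub ht')
    exact neg_nonpos.2 (mul_nonneg hK (by positivity))
  have := hanti ⟨le_rfl, hm₁.2⟩ ⟨by linarith [ht₁.2, ht₂.1], ht₂.2.le⟩
    (by linarith [ht₁.2, ht₂.1] : t₁ ≤ t₂)
  simp only at this
  linarith

lemma IsShooting.obstacle_le {ψ : ℝ → ℝ} (hψ : IsObstacle ψ) (hc : IsSymmetricCone ψ)
    (H : IsShooting (ψ (1 / 2)) σ) {s : ℝ} (hs : s ∈ Icc 0 (2 * halfLength σ)) :
    ψ (gluedCurve σ s 0) ≤ gluedCurve σ s 1 := by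
  have key : ∀ s ∈ Icc 0 (halfLength σ), ψ (leftX σ s) ≤ leftY σ s := fun s hs =>
    (hc.le_chord hψ (H.leftX_le hs)).trans (H.chord_le (hc.tip_pos hψ) hs)
  rcases le_total s (halfLength σ) with h | h
  · rw [gluedCurve_left h]
    exact key s ⟨hs.1, h⟩
  · rw [H.gluedCurve_right h]
    change ψ (1 - leftX σ (2 * halfLength σ - s)) ≤ leftY σ (2 * halfLength σ - s)
    rw [← hc.2]
    exact key _ ⟨by linarith [hs.2], by linarith⟩

/-! ### Existence -/

lemma contDiff_leftK (σ : ℝ) : ContDiff ℝ 2 (leftK σ) := by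
  have hd : deriv (leftK σ) = fun s => scale σ ^ 2 * rectS (scale σ * s) :=
    funext fun s => (hasDerivAt_leftK σ s).deriv
  have h1 : ContDiff ℝ 1 fun s => scale σ ^ 2 * rectS (scale σ * s) :=
    contDiff_one_of_hasDerivAt
      (fun s => (hasDerivAt_scaled hasDerivAt_rectS (scale σ) s).const_mul _)
      (continuous_const.mul (continuous_const.mul
        (((continuous_rectY.comp (continuous_const.mul continuous_id)).pow 3).div_const 2).neg))
  refine (contDiff_succ_iff_deriv (n := 1)).2 ⟨fun s => (hasDerivAt_leftK σ s).differentiableAt,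
    by simp, ?_⟩
  rwa [hd]

lemma IsShooting.exists_scf {ψ : ℝ → ℝ} (hψ : IsObstacle ψ) (hc : IsSymmetricCone ψ)
    (H : IsShooting (ψ (1 / 2)) σ) : ∃ γ ∈ AdmissibleSym ψ, IsSCF ψ γ := by
  set b := halfLength σ
  have hb : 0 < b := H.halfLength_pos
  set L := 2 * b with hL
  have hLpos : 0 < L := by positivity
  obtain ⟨hd, hlen, harc⟩ := constant_speed hLpos H.hasDerivAt_gluedCurve
    fun s _ => norm_gluedTangent σ s
  set γ : ℝ → Plane := fun x => gluedCurve σ (L * x) with hγ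
  have hmem : ∀ x ∈ Icc (0 : ℝ) 1, L * x ∈ Icc 0 L := fun x hx =>
    ⟨mul_nonneg hLpos.le hx.1, mul_le_of_le_one_right hLpos.le hx.2⟩
  have hmul : ∀ x, HasDerivAt (fun x : ℝ => L * x) L x := fun x => by
    simpa using (hasDerivAt_id x).const_mul L
  have hcm : Continuous fun x : ℝ => L * x := by fun_prop
  have hadm : γ ∈ Admissible ψ := by
    refine ⟨isW22_of_hasDerivAt (f' := fun x => L • gluedTangent σ (L * x))
      (f'' := fun x => L • L • gluedSecond σ (L * x))
      (H.continuous_gluedCurve.comp hcm).continuousOn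
      (fun x _ => (H.hasDerivAt_gluedCurve (L * x)).scomp x (hmul x))
      ((H.continuous_gluedTangent.comp hcm).const_smul L).continuousOn
      (fun x _ => ((H.hasDerivAt_gluedTangent (L * x)).scomp x (hmul x)).const_smul L)
      (((H.continuous_gluedSecond.comp hcm).const_smul L).const_smul L).continuousOn,
      fun x hx => ?_, ?_, ?_, fun x hx => H.obstacle_le hψ hc (hmem x hx)⟩
    · rw [hd x hx]
      refine smul_ne_zero hLpos.ne' fun h0 => ?_
      have := norm_gluedTangent σ (L * x)
      rw [h0, norm_zero] at this
      exact zero_ne_one this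
    · simp only [hγ, mul_zero]
      exact H.gluedCurve_zero
    · simp only [hγ, mul_one]
      exact H.gluedCurve_end
  have hk : ∀ s ∈ Ioo 0 b, signedCurvature γ s = -leftK σ s := fun s hs =>
    H.signedCurvature_left harc hs
  have hhalf : curveLength γ / 2 = b := by rw [hlen, hL]; ring
  refine ⟨γ, ⟨hadm, fun x _ => ?_⟩, hadm, ?_, ?_, ?_, ?_, ?_, ?_⟩
  · simp only [hγ]
    rw [show L * (1 - x) = L - L * x by ring]
    exact H.gluedCurve_symm _
  · rw [hlen]
    intro s hs
    rw [harc s hs, harc _ ⟨by linarith [hs.2], by linarith [hs.1]⟩]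
    exact H.gluedCurve_symm s
  · rw [hhalf]
    exact (contDiff_leftK σ).neg.contDiffOn.congr hk
  · rw [hhalf]
    intro s hs
    have hev : deriv (signedCurvature γ) =ᶠ[𝓝 s] fun s => -(scale σ ^ 2 * rectS (scale σ * s)) := by
      filter_upwards [Ioo_mem_nhds hs.1 hs.2] with t ht
      exact H.deriv_signedCurvature harc ht
    have h2 := (((hasDerivAt_scaled hasDerivAt_rectS (scale σ) s).const_mul
      (scale σ ^ 2)).neg.congr_of_eventuallyEq hev).deriv
    rw [h2, hk s hs, leftK]
    ring
  · have h0 : leftK σ 0 = 0 := by simp [leftK, rectY_zero]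
    have h1 := ((continuous_leftK σ).tendsto 0).neg.mono_left (nhdsWithin_le_nhds (s := Ioi 0))
    rw [h0, neg_zero] at h1
    refine h1.congr' ?_
    filter_upwards [Ioo_mem_nhdsGT hb] with s hs
    exact (hk s hs).symm
  · rw [hhalf]
    intro s hs
    rw [hk s hs, neg_lt_zero]
    have hm := H.scaled_mem (Ioo_subset_Icc_self hs)
    exact mul_pos H.scale_pos
      (rectY_pos (mul_pos H.scale_pos hs.1) (hm.2.trans_lt H.mem.2))
  · rw [hhalf, harc b ⟨hb.le, by linarith⟩]
    exact H.gluedCurve_tip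

end

/-! ### Reparametrizations -/

lemma monotoneOn_of_derivWithin_pos {σ : ℝ → ℝ} {a b : ℝ}
    (hσ : ContDiffOn ℝ 1 σ (Icc a b)) (hpos : ∀ x ∈ Icc a b, 0 < derivWithin σ (Icc a b) x) :
    MonotoneOn σ (Icc a b) :=
  monotoneOn_of_hasDerivWithinAt_nonneg (convex_Icc a b) hσ.continuousOn
    (fun x hx => ((hσ.differentiableOn one_ne_zero x
      (interior_subset hx)).hasDerivWithinAt).mono interior_subset)
    fun x hx => (hpos x (interior_subset hx)).le

lemma mapsTo_of_derivWithin_pos {σ : ℝ → ℝ} {a b c d : ℝ} (hσ : ContDiffOn ℝ 1 σ (Icc a b))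
    (hpos : ∀ x ∈ Icc a b, 0 < derivWithin σ (Icc a b) x) (hc : σ a = c) (hd : σ b = d) :
    MapsTo σ (Icc a b) (Icc c d) := fun x hx => by
  have hm := monotoneOn_of_derivWithin_pos hσ hpos
  have hab : a ≤ b := hx.1.trans hx.2
  exact ⟨hc ▸ hm ⟨le_rfl, hab⟩ hx hx.1, hd ▸ hm hx ⟨hab, le_rfl⟩ hx.2⟩

lemma IsReparam.trans {a b c d e f : ℝ} {γ η ζ : ℝ → Plane} (hab : a < b) (hcd : c < d)
    (h1 : IsReparam a b γ c d η) (h2 : IsReparam c d η e f ζ) : IsReparam a b γ e f ζ := by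
  obtain ⟨σ, hσ, hσp, rfl, rfl, hγ⟩ := h1
  obtain ⟨τ, hτ, hτp, rfl, rfl, hη⟩ := h2
  have hmaps := mapsTo_of_derivWithin_pos hσ hσp rfl rfl
  refine ⟨fun x => τ (σ x), hτ.comp hσ hmaps, fun x hx => ?_, rfl, rfl, fun x hx => ?_⟩
  · have h3 := (hσ.differentiableOn one_ne_zero x hx).hasDerivWithinAt
    have h4 := (hτ.differentiableOn one_ne_zero _ (hmaps hx)).hasDerivWithinAt
    have h5 : HasDerivWithinAt (fun x => τ (σ x)) _ (Icc a b) x := h4.comp x h3 hmaps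
    rw [h5.derivWithin (uniqueDiffOn_Icc hab x hx)]
    exact mul_pos (hτp _ (hmaps hx)) (hσp x hx)
  · rw [hγ x hx, hη _ (hmaps hx)]

/-! ### Which glued curves are graphs -/

section

variable {h σ : ℝ}

/-- A curve that does not start strictly to the right is not a graph. -/
lemma IsShooting.not_isGraphical (H : IsShooting h σ) (hS : rectS σ ≤ 0) {ψ : ℝ → ℝ}
    {γ : ℝ → Plane} {L : ℝ} (hγ : IsReparam 0 1 γ 0 L (gluedCurve σ)) : ¬ IsGraphical ψ γ := by
  rintro ⟨η, ⟨u, -, -, -, -, hη⟩, τ, hτ, hτp, hτ0, hτ1, hγη⟩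
  obtain ⟨ρ, hρ, hρp, hρ0, -, hγρ⟩ := hγ
  have h0 : (0 : ℝ) ∈ Icc (0 : ℝ) 1 := ⟨le_rfl, zero_le_one⟩
  have hmaps := mapsTo_of_derivWithin_pos hτ hτp hτ0 hτ1
  -- On a graph the reparametrization `τ` is the abscissa. Its derivative at `0` would be positive,
  -- whereas the glued curve gives `rectS σ` times the positive derivative of `ρ`.
  have heq : ∀ x ∈ Icc (0 : ℝ) 1, gluedCurve σ (ρ x) 0 = τ x := fun x hx => by
    rw [← hγρ x hx, hγη x hx, hη _ (hmaps hx)]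
    rfl
  have h1 := (hτ.differentiableOn one_ne_zero 0 h0).hasDerivWithinAt
  have h2 := (hρ.differentiableOn one_ne_zero 0 h0).hasDerivWithinAt
  have h3 : HasDerivWithinAt (fun x => gluedCurve σ (ρ x) 0)
      (gluedTangent σ (ρ 0) 0 * derivWithin ρ (Icc 0 1) 0) (Icc 0 1) 0 :=
    (HasDerivAt.plane_apply (H.hasDerivAt_gluedCurve (ρ 0)) 0).comp_hasDerivWithinAt (0 : ℝ) h2
  have h4 := h1.congr heq (heq 0 h0)
  have h5 := (uniqueDiffOn_Icc zero_lt_one (0 : ℝ) h0).eq_deriv _ h3 h4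
  have h6 : gluedTangent σ (ρ 0) 0 = rectS σ := by
    rw [hρ0, gluedTangent_left H.halfLength_pos.le]
    exact leftP_zero σ
  rw [h6] at h5
  have := hτp 0 h0
  have := mul_nonpos_of_nonpos_of_nonneg hS (hρp 0 h0).le
  linarith

lemma IsShooting.gluedTangent_pos (H : IsShooting h σ) (hσ : σ < completeK qRect) {s : ℝ}
    (hs : s ∈ Icc 0 (2 * halfLength σ)) : 0 < gluedTangent σ s 0 := by
  have key : ∀ s ∈ Icc 0 (halfLength σ), 0 < leftP σ s := fun s hs => by
    have hm := H.scaled_mem hs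
    have h1 : 0 < rectS σ := (rectS_pos_iff H.mem.1.le H.mem.2.le).2 hσ
    have h2 : 0 < rectS (scale σ * s) :=
      (rectS_pos_iff hm.1 (hm.2.trans H.mem.2.le)).2 (hm.2.trans_lt hσ)
    simp only [leftP]
    positivity
  rcases le_total s (halfLength σ) with h | h
  · rw [gluedTangent_left h]
    exact key s ⟨hs.1, h⟩
  · rw [H.gluedTangent_right h]
    exact key _ ⟨by linarith [hs.2], by linarith⟩

/-- A short glued curve is a graph. -/
lemma IsShooting.exists_graph (H : IsShooting h σ) (hσ : σ < completeK qRect) {ψ : ℝ → ℝ}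
    (hψ : ∀ s ∈ Icc 0 (2 * halfLength σ), ψ (gluedCurve σ s 0) ≤ gluedCurve σ s 1) :
    ∃ η ∈ AdmissibleGraph ψ, IsReparam 0 (2 * halfLength σ) (gluedCurve σ) 0 1 η := by
  set L := 2 * halfLength σ with hL
  have hLpos : 0 < L := mul_pos two_pos H.halfLength_pos
  have hTpos : ∀ s ∈ Icc 0 L, 0 < gluedTangent σ s 0 := fun s hs => H.gluedTangent_pos hσ hs
  have hTc : ∀ i, Continuous fun s => gluedTangent σ s i := fun i =>
    (EuclideanSpace.proj (𝕜 := ℝ) i : Plane →L[ℝ] ℝ).continuous.comp H.continuous_gluedTangent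
  have hSc : ∀ i, Continuous fun s => gluedSecond σ s i := fun i =>
    (EuclideanSpace.proj (𝕜 := ℝ) i : Plane →L[ℝ] ℝ).continuous.comp H.continuous_gluedSecond
  have hGc : ∀ i, Continuous fun s => gluedCurve σ s i := fun i =>
    (EuclideanSpace.proj (𝕜 := ℝ) i : Plane →L[ℝ] ℝ).continuous.comp H.continuous_gluedCurve
  -- `P` extends the abscissa, so the graph function is the height composed with `Q`.
  obtain ⟨P, Q, v, hvc, hv, hvpos, hm, hP0, hP, hQP, hPQ, hQ⟩ :=
    exists_diffeo_of_pos hLpos.le (hTc 0).continuousOn hTpos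
  have hPc : Continuous P := continuous_iff_continuousAt.2 fun s => (hP s).continuousAt
  have hQc : Continuous Q := continuous_iff_continuousAt.2 fun s => (hQ s).continuousAt
  have hPG : ∀ s ∈ Icc 0 L, P s = gluedCurve σ s 0 := fun s hs => by
    have := eq_left_of_hasDerivAt_zero (f := fun s => P s - gluedCurve σ s 0)
      (hPc.sub (hGc 0)).continuousOn (fun t ht =>
        ((hP t).sub (HasDerivAt.plane_apply (H.hasDerivAt_gluedCurve t) 0)).congr_deriv
          (by rw [hv t (Ioo_subset_Icc_self ht), sub_self])) hs
    simp only [hP0, H.gluedCurve_zero] at this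
    simpa [sub_eq_zero] using this
  have hPL : P L = 1 := by
    rw [hPG L ⟨hLpos.le, le_rfl⟩, hL, H.gluedCurve_end]; rfl
  have hQ0 : Q 0 = 0 := by simpa [hP0] using hQP 0
  have hQ1 : Q 1 = L := by rw [← hPL, hQP]
  have hQm : StrictMono Q := fun s t hst => hm.lt_iff_lt.1 (by rwa [hPQ, hPQ])
  have hQmem : ∀ x ∈ Icc (0 : ℝ) 1, Q x ∈ Icc 0 L := fun x hx =>
    ⟨hQ0 ▸ hQm.monotone hx.1, hQ1 ▸ hQm.monotone hx.2⟩
  have hTne : ∀ x ∈ Icc (0 : ℝ) 1, gluedTangent σ (Q x) 0 ≠ 0 := fun x hx =>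
    (hTpos _ (hQmem x hx)).ne'
  have hQd : ∀ x ∈ Icc (0 : ℝ) 1, HasDerivAt Q (1 / gluedTangent σ (Q x) 0) x := fun x hx => by
    rw [← hv _ (hQmem x hx)]
    exact hQ x
  have hu : IsW22 fun x => gluedCurve σ (Q x) 1 := by
    refine isW22_of_hasDerivAt
      (f' := fun x => gluedTangent σ (Q x) 1 * (1 / gluedTangent σ (Q x) 0))
      (f'' := fun x => (gluedSecond σ (Q x) 1 * gluedTangent σ (Q x) 0 -
        gluedTangent σ (Q x) 1 * gluedSecond σ (Q x) 0) / gluedTangent σ (Q x) 0 ^ 3)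
      ((hGc 1).comp hQc).continuousOn (fun x hx => ?_) ?_ (fun x hx => ?_) ?_
    · exact (HasDerivAt.plane_apply (H.hasDerivAt_gluedCurve (Q x)) 1).comp x
        (hQd x (Ioo_subset_Icc_self hx))
    · exact ((hTc 1).comp hQc).continuousOn.mul
        (continuousOn_const.div ((hTc 0).comp hQc).continuousOn hTne)
    · have hne := hTne x (Ioo_subset_Icc_self hx)
      have hq := hQd x (Ioo_subset_Icc_self hx)
      have d : ∀ i, HasDerivAt (fun x => gluedTangent σ (Q x) i)
          (gluedSecond σ (Q x) i * (1 / gluedTangent σ (Q x) 0)) x := fun i =>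
        (HasDerivAt.plane_apply (H.hasDerivAt_gluedTangent (Q x)) i).comp x hq
      refine ((d 1).mul ((hasDerivAt_const x (1 : ℝ)).div (d 0) hne)).congr_deriv ?_
      simp only [Pi.div_apply]
      field_simp
      ring
    · exact ((((hSc 1).comp hQc).mul ((hTc 0).comp hQc)).sub
        (((hTc 1).comp hQc).mul ((hSc 0).comp hQc))).continuousOn.div
        (((hTc 0).comp hQc).pow 3).continuousOn fun x hx => pow_ne_zero 3 (hTne x hx)
  refine ⟨fun x => !₂[x, gluedCurve σ (Q x) 1], ⟨_, hu, ?_, ?_, fun x hx => ?_, fun x _ => rfl⟩,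
    P, (contDiff_one_of_hasDerivAt hP hvc).contDiffOn, fun s hs => ?_, hP0, hPL, fun s hs => ?_⟩
  · simp only [hQ0, H.gluedCurve_zero]; rfl
  · simp only [hQ1, hL, H.gluedCurve_end]; rfl
  · have := hψ _ (hQmem x hx)
    rwa [← hPG _ (hQmem x hx), hPQ] at this
  · rw [(hP s).hasDerivWithinAt.derivWithin (uniqueDiffOn_Icc hLpos s hs)]
    exact hvpos s
  · refine plane_ext (hPG s hs).symm ?_
    change gluedCurve σ s 1 = gluedCurve σ (Q (P s)) 1
    rw [hQP]

/-! ### The critical case -/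

lemma scale_mid : scale (completeK qRect) = alphaRect := by
  rw [scale, shootH_mid]; ring

lemma two_mul_halfLength_mid : 2 * halfLength (completeK qRect) = lengthRect := by
  rw [halfLength, scale_mid, lengthRect]; ring

lemma alphaRect_mul_lengthRect : alphaRect * lengthRect = 2 * completeK qRect :=
  mul_div_cancel₀ _ alphaRect_pos.ne'

lemma left_mid (s : ℝ) :
    leftX (completeK qRect) s = rectX (alphaRect * s) / alphaRect ∧
      leftY (completeK qRect) s = rectY (alphaRect * s) / alphaRect := by
  have h2 : √2 ^ 2 = (2 : ℝ) := Real.sq_sqrt (by norm_num)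
  simp [leftX, leftY, scale_mid, rectY_mid, rectS_mid, h2]

/-- At `K` the tangent of the rectangular elastica is already `(1, 0)`, so no rotation is needed,
and the elastica is symmetric about `K`, so reflecting it continues it. -/
lemma IsShooting.gluedCurve_mid (H : IsShooting h (completeK qRect)) (s : ℝ) :
    gluedCurve (completeK qRect) s = gammaRect s := by
  have hα := alphaRect_pos.ne'
  have hG : gammaRect s = !₂[rectX (alphaRect * s) / alphaRect,
      rectY (alphaRect * s) / alphaRect] := by
    rw [gammaRect_eq]
    apply plane_ext <;> simp <;> ring
  rw [hG]
  rcases le_total s (halfLength (completeK qRect)) with h | h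
  · rw [gluedCurve_left h, (left_mid s).1, (left_mid s).2]
  · rw [H.gluedCurve_right h, two_mul_halfLength_mid, (left_mid _).1, (left_mid _).2, mul_sub,
      alphaRect_mul_lengthRect, rectX_symm, rectY_symm]
    congr 2
    field_simp
    ring_nf

/-- By symmetry of `rectY` about `K` both branches of the curvature are the same smooth function
near the midpoint, which makes the derivative two-sided. -/
lemma IsShooting.hasDerivAt_signedCurvature_mid (H : IsShooting h (completeK qRect))
    {γ : ℝ → Plane} (hγ : ∀ s ∈ Icc 0 (2 * halfLength (completeK qRect)),
      arcParam γ s = gluedCurve (completeK qRect) s) :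
    HasDerivAt (signedCurvature γ) 0 (halfLength (completeK qRect)) := by
  have hb := H.halfLength_pos
  have h1 := (hasDerivAt_leftK (completeK qRect) (halfLength (completeK qRect))).neg
  rw [H.scale_mul, rectS_mid, mul_zero, neg_zero] at h1
  refine h1.congr_of_eventuallyEq ?_
  filter_upwards [Ioo_mem_nhds hb (show halfLength (completeK qRect) <
    2 * halfLength (completeK qRect) by linarith)] with s hs
  rw [H.signedCurvature_eq hγ hs]
  split_ifs
  · rfl
  · have : scale (completeK qRect) * (2 * halfLength (completeK qRect) - s) =
        2 * completeK qRect - scale (completeK qRect) * s := by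
      linear_combination 2 * H.scale_mul
    simp only [Pi.neg_apply, leftK, this, rectY_symm]

end

end ElasticObstacle

end

/-! ### Assembly: existence, uniqueness and the three cases -/

open ElasticObstacle
theorem lemma4p3 (ψ : ℝ → ℝ) (hψ : IsObstacle ψ) (hcone : IsSymmetricCone ψ) :
    (∃ γ ∈ AdmissibleSym ψ, IsSCF ψ γ) ∧
    (∀ γ η : ℝ → Plane, IsSCF ψ γ → IsSCF ψ η → IsReparam 0 1 γ 0 1 η) ∧
    ∀ γ : ℝ → Plane, IsSCF ψ γ →
      (ψ (1 / 2) < hStar →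
        IsGraphical ψ γ ∧
        ∃ c < 0, Tendsto (deriv (signedCurvature γ)) (𝓝[<] (curveLength γ / 2)) (𝓝 c)) ∧
      (ψ (1 / 2) = hStar →
        IsReparam 0 1 γ 0 lengthRect gammaRect ∧
        HasDerivAt (signedCurvature γ) 0 (curveLength γ / 2) ∧
        ¬ IsGraphical ψ γ) ∧
      (hStar < ψ (1 / 2) →
        ¬ IsGraphical ψ γ ∧
        ∃ c > 0, Tendsto (deriv (signedCurvature γ)) (𝓝[<] (curveLength γ / 2)) (𝓝 c)) := by
  have hh := hcone.tip_pos hψ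
  refine ⟨?_, fun γ η hγ hη => ?_, fun γ hγ => ?_⟩
  · obtain ⟨σ, hσ, hpos, hslope⟩ := shooting_exists hh
    exact IsShooting.exists_scf hψ hcone ⟨hσ, hpos, hslope⟩
  · obtain ⟨σ, H, hlen, harc⟩ := hγ.exists_shooting hh
    obtain ⟨τ, H', hlen', harc'⟩ := hη.exists_shooting hh
    obtain rfl : σ = τ := shooting_unique H.mem H'.mem H.pos H'.pos H.slope H'.slope
    have hl : curveLength γ = curveLength η := hlen.trans hlen'.symm
    exact isReparam_of_arcParam_eq_arcParam (Admissible.contDiffOn hγ.mem) hγ.mem.2.1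
      (Admissible.contDiffOn hη.mem) hη.mem.2.1 hl
      fun s hs => (harc s hs).trans (harc' s (hl ▸ hs)).symm
  · obtain ⟨σ, H, hlen, harc⟩ := hγ.exists_shooting hh
    have hrep := isReparam_of_arcParam_eq (Admissible.contDiffOn hγ.mem) hγ.mem.2.1 harc
    have hhalf : curveLength γ / 2 = halfLength σ := by rw [hlen]; ring
    rw [hlen] at harc hrep
    rw [hhalf]
    have hL : 0 < 2 * halfLength σ := mul_pos two_pos H.halfLength_pos
    have hs2 : 0 < scale σ ^ 2 := pow_pos H.scale_pos 2
    refine ⟨fun hlt => ⟨?_, _, ?_, H.tendsto_deriv_signedCurvature harc⟩, fun heq => ?_,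
      fun hlt => ⟨?_, _, ?_, H.tendsto_deriv_signedCurvature harc⟩⟩
    · obtain ⟨η, hη, hre⟩ := H.exists_graph ((shooting_lt_mid_iff H.mem H.pos H.slope).1 hlt)
        fun s hs => H.obstacle_le hψ hcone hs
      exact ⟨η, hη, hrep.trans zero_lt_one hL hre⟩
    · have := (rectS_pos_iff H.mem.1.le H.mem.2.le).2
        ((shooting_lt_mid_iff H.mem H.pos H.slope).1 hlt)
      exact neg_neg_of_pos (mul_pos hs2 this)
    · obtain rfl : σ = completeK qRect := by
        have h1 := shooting_lt_mid_iff H.mem H.pos H.slope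
        have h2 := mid_lt_shooting_iff H.mem H.pos H.slope
        exact le_antisymm (not_lt.1 fun h => (h2.2 h).ne' heq) (not_lt.1 fun h => (h1.2 h).ne heq)
      refine ⟨?_, H.hasDerivAt_signedCurvature_mid harc, H.not_isGraphical rectS_mid.le hrep⟩
      rw [two_mul_halfLength_mid, show gluedCurve (completeK qRect) = gammaRect from
        funext H.gluedCurve_mid] at hrep
      exact hrep
    · exact H.not_isGraphical ((rectS_neg_iff H.mem.1.le H.mem.2.le).2
        ((mid_lt_shooting_iff H.mem H.pos H.slope).1 hlt)).le hrep
    · have := (rectS_neg_iff H.mem.1.le H.mem.2.le).2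
        ((mid_lt_shooting_iff H.mem H.pos H.slope).1 hlt)
      exact neg_pos.2 (mul_neg_of_pos_of_neg hs2 this)
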